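/- Let $K$ be a number field with algebraic closure $\overline{K}$, and let $S$ be a nonempty finite set of places of $K$. For a place $v$ put $d_v=[K_v:\mathbb{Q}_v]/[K:\mathbb{Q}]$, let $|\cdot|_v$ be the absolute value on $K$ extending the usual archimedean or $p$-adic one of $\mathbb{Q}$, let $\mathsf{A}^1_v$ and $\mathsf{P}^1_v$ be the Berkovich affine and projective lines over $\mathbb{C}_v$ ($\mathbb{C}$ and $\mathbb{P}^1(\mathbb{C})$ if $v\mid\infty$), and let $|z-w|_v$ also denote the Hsia kernel on $\mathsf{A}^1_v$ if $v$ is finite. For $s>0$ let $\lambda_{s,v}$ be the normalized arc length measure on $|z|=s$ if $v\mid\infty$, and the point mass at the point $\zeta_{0,s}$ of the disc $\overline{D}_v(0,s)$ if $v$ is finite. Let $\rho=(\rho_v)_v$ be the areal adelic measure with all radii $1$, i.e. $\rho_v=\int_0^1\lambda_{s,v}\,2s\,ds$ if $v\in S$ and $\rho_v=\lambda_{1,v}$ if $v\notin S$. Choose for each $v$ a field embedding $\sigma_v:\overline{K}\to\mathbb{C}_v$ that is an isometry on $(K,|\cdot|_v)$, extended by $\sigma_v(\infty)=\infty$. For $\alpha\in\mathbb{P}^1(\overline{K})$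 with $K$-conjugates $\alpha_1,\dots,\alpha_n$ put $[\alpha]_v=\frac1n\sum_{k=1}^n\delta_{\sigma_v(\alpha_k)}$, and let $$h_\rho(\alpha)=\frac12\sum_v d_v\,(\rho_v-[\alpha]_v,\rho_v-[\alpha]_v)_v,\qquad (\mu,\nu)_v=\iint_{\mathsf{A}^1_v\times\mathsf{A}^1_v\setminus\mathrm{Diag}}-\log|z-w|_v\,d\mu(w)\,d\nu(z).$$ Let $\mathcal{L}(\rho)=\liminf_{\alpha\in\mathbb{P}^1(\overline{K})}h_\rho(\alpha)$ be the essential minimum, and let $[K(\infty):K]=1$. Then there is a sequence $(\alpha_n)_{n\ge1}$ of distinct points of $\mathbb{P}^1(\overline{K})$ with $h_\rho(\alpha_n)>h_\rho(\infty)$ for all $n$ and $$\lim_{n\to\infty}[K(\alpha_n):K]\,\bigl(h_\rho(\alpha_n)-h_\rho(\infty)\bigr)=0.$$ Moreover $\mathcal{L}(\rho)=h_\rho(\infty)$, and consequently there is no $\varepsilon>0$ such that $[K(\alpha):K]\,(h_\rho(\alpha)-\mathcal{L}(\rho))\ge\varepsilon$ for every $\alpha\in\mathbb{P}^1(\overline{K})$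 with $h_\rho(\alpha)>\mathcal{L}(\rho)$. -/

import Mathlib

open Polynomial MeasureTheory NumberField IsDedekindDomain Filter Topology
open scoped ENNReal

noncomputable section

namespace ArealHeight

/-! ### One-point compactifications and energies

For a local affine line `A` (either `ℂ` or the Berkovich affine line), the projective line is the
one-point compactification of `A`, with its Borel `σ`-algebra. -/

instance onePointMeasurableSpace (A : Type*) [TopologicalSpace A] :
    MeasurableSpace (OnePoint A) := borel _

instance onePointBorelSpace (A : Type*) [TopologicalSpace A] : BorelSpace (OnePoint A) := ⟨rfl⟩

open Classical in
/-- The function `- log κ(z, w)` on `A × A` minus the diagonal, extended by `0` to the complement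
of this set in the product of the projective line with itself. -/
def negLogKernel {A : Type*} (κ : A → A → ℝ) (z w : OnePoint A) : ℝ :=
  z.elim 0 fun a => w.elim 0 fun b => if a = b then 0 else - Real.log (κ a b)

/-- The mutual energy `∬ - log κ(z, w) dμ(w) dν(z)`, the integral being over `A × A` minus
the diagonal, of two (positive) measures on the projective line. -/
def energy {A : Type*} [TopologicalSpace A] (κ : A → A → ℝ) (μ ν : Measure (OnePoint A)) : ℝ :=
  ∫ z, ∫ w, negLogKernel κ z w ∂μ ∂ν

/-- The energy `(μ - ν, μ - ν)` of the signed measure `μ - ν`, by bilinearity. -/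
def energySub {A : Type*} [TopologicalSpace A] (κ : A → A → ℝ)
    (μ ν : Measure (OnePoint A)) : ℝ :=
  energy κ μ μ - energy κ μ ν - energy κ ν μ + energy κ ν ν

/-! ### The Berkovich affine line -/

section Berkovich

variable (C : Type*) [NormedField C]

/-- The Berkovich affine line over `C`: multiplicative seminorms on `C[T]` that extend the norm
of `C`. -/
def BerkovichLine : Type _ := {x : MulRingSeminorm C[X] // ∀ a : C, x (Polynomial.C a) = ‖a‖}

variable {C}

instance : CoeFun (BerkovichLine C) fun _ => C[X] → ℝ := ⟨fun x => x.1⟩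

/-- The topology of pointwise convergence. -/
instance : TopologicalSpace (BerkovichLine C) :=
  TopologicalSpace.induced (fun (x : BerkovichLine C) (p : C[X]) => x p) inferInstance

/-- The seminorm `p ↦ |p(a)|`, i.e. `a ∈ C` as a point of the Berkovich line. -/
def classicalPoint (a : C) : BerkovichLine C :=
  ⟨{ toFun := fun p => ‖p.eval a‖
     map_zero' := by simp
     add_le' := fun p q => by simpa using norm_add_le (p.eval a) (q.eval a)
     neg' := fun p => by simp
     map_one' := by simp
     map_mul' := fun p q => by simp }, fun b => by
      change ‖(Polynomial.C b).eval a‖ = ‖b‖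
      rw [eval_C]⟩

/-- The Hsia kernel `δ(x, y)`: the infimum of the radii of the closed Berkovich discs that
contain both `x` and `y` (the closed disc of centre `a` and radius `r` consists of the seminorms
`x` with `x (T - a) ≤ r`). It extends `|a - b|` from classical points. -/
def hsiaKernel (x y : BerkovichLine C) : ℝ :=
  ⨅ a : C, max (x (X - Polynomial.C a)) (y (X - Polynomial.C a))

/-- The norm of `C` as an absolute value. -/
def normAbs (C : Type*) [NormedField C] : AbsoluteValue C ℝ :=
  IsAbsoluteValue.toAbsoluteValue (norm : C → ℝ)

theorem isNonarchimedean_normAbs [IsUltrametricDist C] : IsNonarchimedean (normAbs C) :=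
  fun a b => IsUltrametricDist.norm_add_le_max a b

variable [IsUltrametricDist C]

/-- The Gauss point `ζ_{0,r}` of the disc of centre `0` and radius `r > 0`: the seminorm
`∑ cᵢ Tⁱ ↦ max |cᵢ| rⁱ`, which is the supremum seminorm of that disc. -/
def gaussPoint (r : ℝ) (hr : 0 < r) : BerkovichLine C :=
  ⟨{ toFun := fun p => p.gaussNorm (normAbs C) r
     map_zero' := by simp
     add_le' := fun p q =>
      (isNonarchimedean_gaussNorm _ isNonarchimedean_normAbs hr.le p q).trans
        (max_le_add_of_nonneg (gaussNorm_nonneg _ _ hr.le) (gaussNorm_nonneg _ _ hr.le))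
     neg' := fun p => by
      rw [show -p = Polynomial.C (-1) * p by simp,
        gaussNorm_mul isNonarchimedean_normAbs hr, gaussNorm_C, (normAbs C).map_neg,
        (normAbs C).map_one, one_mul]
     map_one' := by
      simpa using gaussNorm_C (normAbs C) r (1 : C)
     map_mul' := gaussNorm_mul isNonarchimedean_normAbs hr }, fun a => by
      change (Polynomial.C a).gaussNorm (normAbs C) r = ‖a‖
      rw [gaussNorm_C]; rfl⟩

/-- The point `ζ_{0,r}`; for `r ≤ 0` it is understood as the classical point `0`. -/
def discPoint (r : ℝ) : BerkovichLine C :=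
  if hr : 0 < r then gaussPoint r hr else classicalPoint 0

variable (C) in
/-- The measure `λ_r` at a finite place: the point mass at `ζ_{0,r}`. -/
def berkovichCircle (r : ℝ) : Measure (OnePoint (BerkovichLine C)) :=
  Measure.dirac ((discPoint r : BerkovichLine C) : OnePoint (BerkovichLine C))

end Berkovich

/-- The measure `λ_r` at an infinite place: the normalized arc length measure on the circle
`|z| = r`. -/
def complexCircle (r : ℝ) : Measure (OnePoint ℂ) :=
  (ENNReal.ofReal (2 * Real.pi))⁻¹ •
    (volume.restrict (Set.Ioc 0 (2 * Real.pi))).map fun θ => ((circleMap 0 r θ : ℂ) : OnePoint ℂ)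

/-- The probability measure `2 r dr / R²` on `(0, R)`. -/
def radialMeasure (R : ℝ) : Measure ℝ :=
  (volume.restrict (Set.Ioo 0 R)).withDensity fun r => ENNReal.ofReal (2 * r / R ^ 2)

/-- The areal measure `∫₀ᴿ λ_r (2 r dr / R²)` of radius `R`, for a family `λ_r` of circle measures.
For `complexCircle` it is the normalized area measure on the disc of radius `R`. -/
def arealMeasure {A : Type*} [TopologicalSpace A] (circ : ℝ → Measure (OnePoint A)) (R : ℝ) :
    Measure (OnePoint A) :=
  (radialMeasure R).bind circ

/-! ### Places, local degrees and embeddings -/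

section Global

variable (K : Type*) [Field K] [NumberField K]

/-- The places of a number field: the infinite ones, and the finite ones given by the nonzero
primes of the ring of integers. -/
abbrev Place := InfinitePlace K ⊕ HeightOneSpectrum (𝓞 K)

variable {K}

/-- The residue characteristic of a finite place. -/
def residueChar (v : HeightOneSpectrum (𝓞 K)) : ℕ := ringChar (𝓞 K ⧸ v.asIdeal)

instance fact_prime_residueChar (v : HeightOneSpectrum (𝓞 K)) :
    Fact (residueChar v).Prime := by
  have : NeZero v.asIdeal := ⟨v.ne_bot⟩
  rw [residueChar, Ideal.ringChar_quot]
  exact ⟨Nat.absNorm_under_prime v.asIdeal⟩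

/-- The local degree `[K_v : ℚ_v]` at a finite place, where `ℚ_v` is the closure of `ℚ` (the
smallest subfield) in the completion `K_v`. -/
def finiteLocalDegree (v : HeightOneSpectrum (𝓞 K)) : ℕ :=
  Module.finrank (⊥ : Subfield (v.adicCompletion K)).topologicalClosure (v.adicCompletion K)

/-- The absolute value at a finite place `v` over `p`, normalized by `|p|_v = 1/p`: the
`[K_v : ℚ_p]`-th root of the absolute value `N(v) ^ (- ord_v x)`. -/
def finiteAbs (v : HeightOneSpectrum (𝓞 K)) (x : K) : ℝ :=
  HeightOneSpectrum.adicAbv K v x ^ ((finiteLocalDegree v : ℝ)⁻¹)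

variable (K)

/-- A choice, for every place `v`, of an embedding of the algebraic closure of `K` into `ℂ_v`
(`ℂ` if `v` is infinite, `ℂ_p` if `v` divides `p`) that is an isometry on `(K, |·|_v)`. -/
structure PlaceEmbeddings where
  inf : InfinitePlace K → (AlgebraicClosure K →+* ℂ)
  fin : ∀ v : HeightOneSpectrum (𝓞 K), AlgebraicClosure K →+* ℂ_[residueChar v]
  norm_inf : ∀ v x, ‖inf v (algebraMap K _ x)‖ = v x
  norm_fin : ∀ v x, ‖fin v (algebraMap K _ x)‖ = finiteAbs v x

/-- A family of measures on the local projective lines, one for each place of `K`. -/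
structure MeasureFamily where
  inf : InfinitePlace K → Measure (OnePoint ℂ)
  fin : ∀ v : HeightOneSpectrum (𝓞 K), Measure (OnePoint (BerkovichLine ℂ_[residueChar v]))

variable {K}

/-- The Galois conjugates over `K` of a point of the projective line over the algebraic closure. -/
def conjugates (α : OnePoint (AlgebraicClosure K)) : Finset (OnePoint (AlgebraicClosure K)) := by
  classical
  exact α.elim {OnePoint.infty} fun a => ((minpoly K a).aroots (AlgebraicClosure K)).toFinset.image (↑)

/-- The degree `[K(α) : K]`, equal to `1` for `α = ∞`. -/
def pointDegree (α : OnePoint (AlgebraicClosure K)) : ℕ :=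
  α.elim 1 fun a => Module.finrank K (IntermediateField.adjoin K {a})

/-- The probability measure supported equally on the images under `s` of the conjugates of `α`. -/
def conjugateMeasure {A : Type*} [TopologicalSpace A] (s : AlgebraicClosure K → A)
    (α : OnePoint (AlgebraicClosure K)) : Measure (OnePoint A) :=
  ((conjugates α).card : ℝ≥0∞)⁻¹ • ∑ β ∈ conjugates α, Measure.dirac (OnePoint.map s β)

/-- The family `[α] = ([α]_v)_v`. -/
def pointFamily (σ : PlaceEmbeddings K) (α : OnePoint (AlgebraicClosure K)) : MeasureFamily K where
  inf v := conjugateMeasure (fun a => σ.inf v a) α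
  fin v := conjugateMeasure (fun a => classicalPoint (σ.fin v a)) α

/-- The adelic height
`h_μ(α) = (1/2) ∑_v ([K_v : ℚ_v] / [K : ℚ]) (μ - [α], μ - [α])_v`. -/
def adelicHeight (σ : PlaceEmbeddings K) (μ : MeasureFamily K)
    (α : OnePoint (AlgebraicClosure K)) : ℝ :=
  (1 / 2) *
    ((∑ v : InfinitePlace K, (v.mult : ℝ) / (Module.finrank ℚ K : ℝ) *
        energySub (fun z w : ℂ => ‖z - w‖) (μ.inf v) ((pointFamily σ α).inf v)) +
      ∑ᶠ v : HeightOneSpectrum (𝓞 K), (finiteLocalDegree v : ℝ) / (Module.finrank ℚ K : ℝ) *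
        energySub hsiaKernel (μ.fin v) ((pointFamily σ α).fin v))

/-- The essential minimum: the limit inferior of the height over the points of the projective line
over the algebraic closure. -/
def essentialMinimum (σ : PlaceEmbeddings K) (μ : MeasureFamily K) : ℝ :=
  liminf (adelicHeight σ μ) cofinite

open Classical in
/-- The areal adelic measure with radius `r v` at the places `v ∈ S`, and the standard measure
`λ_1` (arc length on the unit circle, or the point mass at `ζ_{0,1}`) at the other places. -/
def arealFamily (S : Finset (Place K)) (r : Place K → ℝ) : MeasureFamily K where
  inf v := if Sum.inl v ∈ S then arealMeasure complexCircle (r (Sum.inl v)) else complexCircle 1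
  fin v := if Sum.inr v ∈ S then arealMeasure (berkovichCircle _) (r (Sum.inr v))
    else berkovichCircle _ 1

end Global

end ArealHeight

end

/-! At every place the integral of log|z - w| against λ_r is log max(r, |z|): by Jensen's formula if
v is infinite, by evaluating a seminorm at T - z if v is finite. Averaging over r with weight 2r dr
gives g(|z|), where g(t) = log t for t ≥ 1 and g(t) = (t² - 1)/2 for t < 1; the standard measure
gives log⁺ t.

Expand the energy of ρ - [a] for a ≠ 0. The products of conjugates and of differences of conjugates
lie in K, so the product formula removes them. What remains (`adelicHeight_coe`) is h(a) = h(∞) +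
∑_v d_v · (mean over the conjugates b of the defect g_v(|b|_v) - log|b|_v). Defects are nonnegative
and vanish for |b|_v ≥ 1, so only the point 0 could lie below h(∞).

For v in S the defect vanishes to second order at |b|_v = 1, whereas the defect -log|b|_v of the
standard measure has a simple zero. Minkowski's theorem provides c in K with |c|_w < 1 at one place
w of S and |c|_v ≥ 1 at all others (`exists_large_only_at_infinite`, `exists_large_only_at_finite`).
An n-th root of c has degree at most n and, by `arealDefect_le_log_sq`, excess height at most d_w
(log|c|_w / n)². Degree times excess is thus O(1/n). Since degrees are at least 1, the excess tends
to 0 as well, which determines the essential minimum. -/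

noncomputable section

namespace ArealHeight

/-! ### Energies of discrete measures -/

section LocalEnergy

variable {A : Type*}

theorem negLogKernel_infty_left (κ : A → A → ℝ) (w : OnePoint A) :
    negLogKernel κ OnePoint.infty w = 0 := rfl

theorem negLogKernel_infty_right (κ : A → A → ℝ) (z : OnePoint A) :
    negLogKernel κ z OnePoint.infty = 0 := by
  induction z using OnePoint.rec <;> rfl

open Classical in
-- The convention `Real.log 0 = 0` agrees with removing the diagonal whenever κ vanishes there. The
-- Hsia kernel does not vanish on the diagonal at disc points, hence the hypothesis.
theorem negLogKernel_coe (κ : A → A → ℝ) (a b : A) (h : a = b → κ a b = 0) :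
    negLogKernel κ (a : OnePoint A) (b : OnePoint A) = - Real.log (κ a b) := by
  change (if a = b then 0 else - Real.log (κ a b)) = _
  split_ifs with hab
  · rw [h hab]; simp
  · rfl

open Classical in
theorem negLogKernel_comm {κ : A → A → ℝ} (hκ : ∀ a b, κ a b = κ b a) (z w : OnePoint A) :
    negLogKernel κ z w = negLogKernel κ w z := by
  induction z using OnePoint.rec with
  | infty => rw [negLogKernel_infty_left, negLogKernel_infty_right]
  | coe a =>
    induction w using OnePoint.rec with
    | infty => rw [negLogKernel_infty_left, negLogKernel_infty_right]
    | coe b =>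
      change (if a = b then 0 else - Real.log (κ a b)) = (if b = a then 0 else - Real.log (κ b a))
      rw [hκ a b]
      simp only [eq_comm]

theorem energy_dirac_self [TopologicalSpace A] [T1Space A] (κ : A → A → ℝ) (x : A) :
    energy κ (Measure.dirac (x : OnePoint A)) (Measure.dirac (x : OnePoint A)) = 0 := by
  rw [energy, integral_dirac, integral_dirac]
  exact if_pos rfl

variable {K : Type*} [Field K]

open Classical in
/-- The conjugates over `K` of an algebraic number. -/
def conjSet (a : AlgebraicClosure K) : Finset (AlgebraicClosure K) :=
  ((minpoly K a).aroots (AlgebraicClosure K)).toFinset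

theorem mem_conjSet {a b : AlgebraicClosure K} :
    b ∈ conjSet a ↔ aeval b (minpoly K a) = 0 := by
  simp only [conjSet, Multiset.mem_toFinset]
  rw [mem_aroots]
  exact and_iff_right (minpoly.ne_zero (Algebra.IsIntegral.isIntegral a))

theorem self_mem_conjSet (a : AlgebraicClosure K) : a ∈ conjSet a :=
  mem_conjSet.2 (minpoly.aeval K a)

theorem card_conjSet_pos (a : AlgebraicClosure K) : 0 < (conjSet a).card :=
  Finset.card_pos.2 ⟨a, self_mem_conjSet a⟩

open Classical in
theorem conjugates_coe (a : AlgebraicClosure K) :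
    conjugates (a : OnePoint (AlgebraicClosure K)) = (conjSet a).image (↑) := by
  rfl

theorem conjugates_infty :
    conjugates (OnePoint.infty : OnePoint (AlgebraicClosure K)) = {OnePoint.infty} := rfl

variable [TopologicalSpace A]

/-- Points are closed, hence measurable, so a finite sum of Dirac masses integrates every real
function without measurability assumptions. -/
theorem integral_conjugateMeasure_coe [T1Space A] (s : AlgebraicClosure K → A)
    (a : AlgebraicClosure K) (f : OnePoint A → ℝ) :
    ∫ z, f z ∂(conjugateMeasure s (a : OnePoint (AlgebraicClosure K))) =
      ((conjSet a).card : ℝ)⁻¹ * ∑ b ∈ conjSet a, f (s b : OnePoint A) := by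
  classical
  have hinj : Function.Injective ((↑) : AlgebraicClosure K → OnePoint (AlgebraicClosure K)) :=
    OnePoint.coe_injective
  rw [conjugateMeasure, conjugates_coe, integral_smul_measure, Finset.card_image_of_injective _ hinj,
    Finset.sum_image hinj.injOn, integral_finsetSum_measure]
  · simp [integral_dirac]
  · intro i _
    exact integrable_dirac (by simp)

theorem conjugateMeasure_infty (s : AlgebraicClosure K → A) :
    conjugateMeasure s (OnePoint.infty : OnePoint (AlgebraicClosure K)) =
      Measure.dirac OnePoint.infty := by
  simp [conjugateMeasure, conjugates_infty]

/-- The point at infinity does not interact with any measure. -/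
theorem energySub_infty [T1Space A] (κ : A → A → ℝ) (s : AlgebraicClosure K → A)
    (ρ : Measure (OnePoint A)) :
    energySub κ ρ (conjugateMeasure s (OnePoint.infty : OnePoint (AlgebraicClosure K))) =
      energy κ ρ ρ := by
  simp [conjugateMeasure_infty, energySub, energy, integral_dirac, negLogKernel_infty_left,
    negLogKernel_infty_right]

/-- The energy of `ρ - [a]` in terms of the potential `- g` of `ρ` and of the absolute values `N`
of the differences of conjugates of `a`. -/
theorem energySub_coe [T1Space A] {κ : A → A → ℝ} (hκ : ∀ a b, κ a b = κ b a)
    (s : AlgebraicClosure K → A) (ρ : Measure (OnePoint A))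
    (N : AlgebraicClosure K → ℝ) (g : AlgebraicClosure K → ℝ)
    (hN : ∀ b c, negLogKernel κ (s b : OnePoint A) (s c : OnePoint A) = - Real.log (N (b - c)))
    (hint : ∀ b, Integrable (negLogKernel κ (s b : OnePoint A)) ρ)
    (hg : ∀ b, ∫ w, negLogKernel κ (s b : OnePoint A) w ∂ρ = - g b)
    (a : AlgebraicClosure K) :
    energySub κ ρ (conjugateMeasure s (a : OnePoint (AlgebraicClosure K))) =
      energy κ ρ ρ + 2 * (((conjSet a).card : ℝ)⁻¹ * ∑ b ∈ conjSet a, g b) -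
      ((conjSet a).card : ℝ)⁻¹ ^ 2 * ∑ b ∈ conjSet a, ∑ c ∈ conjSet a, Real.log (N (b - c)) := by
  have h1 : energy κ ρ (conjugateMeasure s (a : OnePoint (AlgebraicClosure K))) =
      - (((conjSet a).card : ℝ)⁻¹ * ∑ b ∈ conjSet a, g b) := by
    rw [energy, integral_conjugateMeasure_coe]
    simp [hg]
  have h2 : energy κ (conjugateMeasure s (a : OnePoint (AlgebraicClosure K))) ρ =
      - (((conjSet a).card : ℝ)⁻¹ * ∑ b ∈ conjSet a, g b) := by
    rw [energy]
    simp only [integral_conjugateMeasure_coe, negLogKernel_comm hκ _ (s _ : OnePoint A)]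
    rw [integral_const_mul, integral_finsetSum _ fun b _ => hint b]
    simp [hg]
  have h3 : energy κ (conjugateMeasure s (a : OnePoint (AlgebraicClosure K)))
      (conjugateMeasure s (a : OnePoint (AlgebraicClosure K))) =
      - (((conjSet a).card : ℝ)⁻¹ ^ 2 *
        ∑ b ∈ conjSet a, ∑ c ∈ conjSet a, Real.log (N (b - c))) := by
    rw [energy]
    simp only [integral_conjugateMeasure_coe, hN, ← Finset.mul_sum, Finset.sum_neg_distrib]
    ring
  rw [energySub, h1, h2, h3]
  ring

end LocalEnergy

/-! ### The radial measure and the radial potential -/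

theorem measurable_radialDensity :
    Measurable fun r : ℝ => ENNReal.ofReal (2 * r / 1 ^ 2) := by
  fun_prop

instance isFiniteMeasure_radialMeasure_one : IsFiniteMeasure (radialMeasure 1) := by
  refine isFiniteMeasure_withDensity_ofReal ?_
  have h : IntegrableOn (fun r : ℝ => 2 * r / 1 ^ 2) (Set.Ioo 0 1) :=
    ((by fun_prop : Continuous fun r : ℝ => 2 * r / 1 ^ 2).integrableOn_Icc).mono_set
      Set.Ioo_subset_Icc_self
  exact h.2

theorem ae_radialMeasure_one : ∀ᵐ r ∂(radialMeasure 1), r ∈ Set.Ioo (0 : ℝ) 1 :=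
  (withDensity_absolutelyContinuous _ _).ae_le (ae_restrict_mem measurableSet_Ioo)

theorem radial_toReal_smul {r : ℝ} (hr : r ∈ Set.Ioo (0 : ℝ) 1) (y : ℝ) :
    (ENNReal.ofReal (2 * r / 1 ^ 2)).toReal • y = 2 * r * y := by
  rw [ENNReal.toReal_ofReal (by have := hr.1; positivity)]
  simp

theorem integrable_radialMeasure_one {f : ℝ → ℝ}
    (hf : IntegrableOn (fun r => 2 * r * f r) (Set.Ioo 0 1)) : Integrable f (radialMeasure 1) := by
  rw [radialMeasure, integrable_withDensity_iff_integrable_smul' measurable_radialDensity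
    (ae_of_all _ fun _ => ENNReal.ofReal_lt_top)]
  exact hf.congr_fun (fun r hr => (radial_toReal_smul hr _).symm) measurableSet_Ioo

theorem integral_radialMeasure_one (f : ℝ → ℝ) :
    ∫ r, f r ∂(radialMeasure 1) = ∫ r in (0 : ℝ)..1, 2 * r * f r := by
  rw [radialMeasure, integral_withDensity_eq_integral_toReal_smul measurable_radialDensity
    (ae_of_all _ fun _ => ENNReal.ofReal_lt_top), intervalIntegral.integral_of_le zero_le_one,
    integral_Ioc_eq_integral_Ioo]
  exact setIntegral_congr_fun measurableSet_Ioo fun r hr => radial_toReal_smul hr _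

theorem continuous_mul_log_max {t : ℝ} (ht : 0 ≤ t) :
    ContinuousOn (fun r : ℝ => 2 * r * Real.log (max r t)) (Set.Icc 0 1) := by
  -- Only t = 0 is delicate: there the weight r absorbs the singularity of log r at the origin.
  rcases ht.eq_or_lt with rfl | ht
  · refine (continuous_const.mul Real.continuous_mul_log).continuousOn.congr
      (f := fun r : ℝ => 2 * (r * Real.log r)) fun r hr => ?_
    simp only [max_eq_left hr.1]
    ring
  · refine Continuous.continuousOn ?_
    exact (by fun_prop : Continuous fun r : ℝ => 2 * r).mul
      ((by fun_prop : Continuous fun r : ℝ => max r t).log fun r => (lt_max_of_lt_right ht).ne')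

theorem integrable_log_max_radialMeasure {t : ℝ} (ht : 0 ≤ t) :
    Integrable (fun r => Real.log (max r t)) (radialMeasure 1) :=
  integrable_radialMeasure_one
    ((continuous_mul_log_max ht).integrableOn_Icc.mono_set Set.Ioo_subset_Icc_self)

/-- The potential `∫₀¹ log (max r t) 2 r dr` of the areal measure of radius one. -/
def arealPotential (t : ℝ) : ℝ := if t < 1 then (t ^ 2 - 1) / 2 else Real.log t

theorem integral_mul_log {t : ℝ} (ht : 0 ≤ t) (ht' : t ≤ 1) :
    ∫ r in t..1, 2 * r * Real.log r = - (1 / 2) - (t ^ 2 * Real.log t - t ^ 2 / 2) := by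
  have key := intervalIntegral.integral_eq_sub_of_hasDerivAt_of_le ht'
    -- The antiderivative r² log r - r²/2 is grouped around r log r, which is continuous at 0, so
    -- that t = 0 is allowed.
    (f := fun r => r * (r * Real.log r) - r ^ 2 / 2) (f' := fun r => 2 * (r * Real.log r)) ?_ ?_ ?_
  · simp only [mul_assoc]
    rw [key]
    simp
    ring
  · exact ((continuous_id.mul Real.continuous_mul_log).sub (by fun_prop)).continuousOn
  · intro r hr
    have hr0 : r ≠ 0 := (ht.trans_lt hr.1).ne'
    have := ((hasDerivAt_id r).mul (Real.hasDerivAt_mul_log hr0)).sub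
      (((hasDerivAt_id r).pow 2).div_const 2)
    refine this.congr_deriv ?_
    simp
    ring
  · exact (continuous_const.mul Real.continuous_mul_log).intervalIntegrable _ _

theorem integral_log_max_radialMeasure {t : ℝ} (ht : 0 ≤ t) :
    ∫ r, Real.log (max r t) ∂(radialMeasure 1) = arealPotential t := by
  rw [integral_radialMeasure_one, arealPotential]
  have hmul (b c : ℝ) : ∫ r in (0 : ℝ)..b, 2 * r * c = b ^ 2 * c := by
    rw [intervalIntegral.integral_mul_const, intervalIntegral.integral_const_mul, integral_id]
    ring
  split_ifs with h1
  · have hI := (continuous_mul_log_max ht).intervalIntegrable_of_Icc zero_le_one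
      (μ := volume)
    -- Cutting at r = t removes the maximum; the two contributions t² log t then cancel.
    rw [← intervalIntegral.integral_add_adjacent_intervals (b := t)
      (hI.mono_set (by
        rw [Set.uIcc_of_le ht, Set.uIcc_of_le zero_le_one]; exact Set.Icc_subset_Icc_right h1.le))
      (hI.mono_set (by
        rw [Set.uIcc_of_le h1.le, Set.uIcc_of_le zero_le_one]; exact Set.Icc_subset_Icc_left ht))]
    rw [intervalIntegral.integral_congr (g := fun r => 2 * r * Real.log t) fun r hr => ?_,
      intervalIntegral.integral_congr (a := t) (g := fun r => 2 * r * Real.log r) fun r hr => ?_,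
      hmul, integral_mul_log ht h1.le]
    · ring
    · rw [Set.uIcc_of_le h1.le] at hr
      simp only [max_eq_left hr.1]
    · rw [Set.uIcc_of_le ht] at hr
      simp only [max_eq_right hr.2]
  · rw [intervalIntegral.integral_congr (g := fun r => 2 * r * Real.log t) fun r hr => ?_, hmul]
    · ring
    · rw [Set.uIcc_of_le zero_le_one] at hr
      simp only [max_eq_right (hr.2.trans (not_lt.1 h1))]

theorem posLog_eq_log_max (t : ℝ) (ht : 0 ≤ t) : Real.log (max 1 t) = Real.posLog t :=
  (Real.posLog_eq_log_max_one ht).symm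

/-- This is log x < x - 1 at x = r². -/
theorem arealDefect_pos {r : ℝ} (hr0 : 0 < r) (hr1 : r < 1) :
    0 < (r ^ 2 - 1) / 2 - Real.log r := by
  have h := Real.log_lt_sub_one_of_pos (x := r ^ 2) (by positivity)
    (pow_lt_one₀ hr0.le hr1 two_ne_zero).ne
  rw [Real.log_pow] at h
  push_cast at h
  linarith

/-! ### The Berkovich affine line -/

section Berkovich

variable {C : Type*} [NormedField C]

theorem BerkovichLine.continuous_eval (p : C[X]) :
    Continuous fun x : BerkovichLine C => x p :=
  (continuous_apply p).comp continuous_induced_dom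

theorem BerkovichLine.ext {x y : BerkovichLine C} (h : ∀ p : C[X], x p = y p) : x = y :=
  Subtype.ext (DFunLike.ext _ _ h)

instance : T2Space (BerkovichLine C) :=
  T2Space.of_injective_continuous (f := fun (x : BerkovichLine C) (p : C[X]) => x p)
    (fun _ _ h => BerkovichLine.ext (congrFun h)) continuous_induced_dom

theorem BerkovichLine.nonneg (x : BerkovichLine C) (p : C[X]) : 0 ≤ x p :=
  apply_nonneg x.1 p

/-- In the binomial expansion of the n-th power, the binomial coefficients have norm at most 1, so
each of the n + 1 terms is at most the n-th power of the maximum. The factor n + 1 disappears on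
taking n-th roots. -/
theorem BerkovichLine.apply_add_C_pow_le [IsUltrametricDist C] (x : BerkovichLine C) (p : C[X])
    (e : C) (n : ℕ) : x (p + Polynomial.C e) ^ n ≤ (n + 1 : ℕ) * max (x p) ‖e‖ ^ n := by
  have hsum : ∀ (s : Finset ℕ) (f : ℕ → C[X]), x.1 (∑ i ∈ s, f i) ≤ ∑ i ∈ s, x.1 (f i) := by
    intro s f
    induction s using Finset.cons_induction with
    | empty => simp
    | cons i s hi ih =>
      rw [Finset.sum_cons, Finset.sum_cons]
      exact (map_add_le_add x.1 _ _).trans (by gcongr)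
  have hconst : ((n + 1 : ℕ) : ℝ) * max (x p) ‖e‖ ^ n =
      ∑ _i ∈ Finset.range (n + 1), max (x p) ‖e‖ ^ n := by simp
  rw [← map_pow x.1, add_pow, hconst]
  refine (hsum _ _).trans (Finset.sum_le_sum fun i hi => ?_)
  have hi' : i ≤ n := Nat.lt_succ_iff.1 (Finset.mem_range.1 hi)
  have hch : x.1 ((n.choose i : ℕ) : C[X]) ≤ 1 := by
    rw [← Polynomial.C_eq_natCast]
    exact (x.2 _).trans_le (IsUltrametricDist.norm_natCast_le_one C _)
  rw [map_mul x.1, map_mul x.1, map_pow x.1, map_pow x.1]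
  calc _ ≤ max (x p) ‖e‖ ^ i * max (x p) ‖e‖ ^ (n - i) * 1 := by
        have h0 : 0 ≤ max (x p) ‖e‖ := (norm_nonneg e).trans (le_max_right _ _)
        have h1 : x.1 p ^ i ≤ max (x p) ‖e‖ ^ i :=
          pow_le_pow_left₀ (x.nonneg p) (le_max_left _ _) i
        have h2 : x.1 (Polynomial.C e) ^ (n - i) ≤ max (x p) ‖e‖ ^ (n - i) :=
          pow_le_pow_left₀ (x.nonneg _) ((x.2 e).trans_le (le_max_right _ _)) _
        exact mul_le_mul (mul_le_mul h1 h2 (pow_nonneg (x.nonneg _) _) (pow_nonneg h0 _)) hch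
          (x.nonneg _) (mul_nonneg (pow_nonneg h0 _) (pow_nonneg h0 _))
    _ = max (x p) ‖e‖ ^ n := by rw [mul_one, ← pow_add, Nat.add_sub_cancel' hi']

/-- Points of the Berkovich line over an ultrametric field are nonarchimedean seminorms. -/
theorem BerkovichLine.apply_add_C_le [IsUltrametricDist C] (x : BerkovichLine C) (p : C[X])
    (e : C) : x (p + Polynomial.C e) ≤ max (x p) ‖e‖ := by
  set M := max (x p) ‖e‖
  have hM : 0 ≤ M := (norm_nonneg e).trans (le_max_right _ _)
  refine le_of_forall_gt_imp_ge_of_dense fun a ha => ?_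
  have ha0 : 0 < a := hM.trans_lt ha
  rcases hM.eq_or_lt with h0 | h0
  · have := x.apply_add_C_pow_le p e 1
    simp only [pow_one] at this
    refine this.trans ?_
    rw [show max (x p) ‖e‖ = 0 from h0.symm]
    simpa using ha0.le
  -- For a > M the powers (a / M)^n outgrow n + 1.
  · obtain ⟨n, hn⟩ := Real.exists_natCast_add_one_lt_pow_of_one_lt ((one_lt_div h0).2 ha)
    rw [div_pow, lt_div_iff₀ (pow_pos h0 n)] at hn
    have hn0 : n ≠ 0 := by
      rintro rfl
      simp at hn
    refine le_of_pow_le_pow_left₀ hn0 ha0.le ((x.apply_add_C_pow_le p e n).trans ?_)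
    push_cast
    exact hn.le

theorem hsiaKernel_comm (x y : BerkovichLine C) : hsiaKernel x y = hsiaKernel y x := by
  simp only [hsiaKernel, max_comm]

theorem classicalPoint_apply (a : C) (p : C[X]) : classicalPoint a p = ‖p.eval a‖ := rfl

/-- A disc containing the classical point a may be recentred at a: write T - a = (T - c) + (c - a)
and use the ultrametric inequality. So the infimum is attained at the centre a. -/
theorem hsiaKernel_classicalPoint [IsUltrametricDist C] (a : C) (x : BerkovichLine C) :
    hsiaKernel (classicalPoint a) x = x (X - Polynomial.C a) := by
  refine le_antisymm ?_ (le_ciInf fun c => ?_)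
  · refine (ciInf_le ⟨0, ?_⟩ a).trans ?_
    · rintro _ ⟨c, rfl⟩
      exact (x.nonneg _).trans (le_max_right _ _)
    · simp [classicalPoint_apply, x.nonneg]
  · rw [show (X - Polynomial.C a : C[X]) = (X - Polynomial.C c) + Polynomial.C (c - a) by simp]
    refine (x.apply_add_C_le _ _).trans (max_le (le_max_right _ _) ?_)
    refine le_max_of_le_left ?_
    rw [classicalPoint_apply, norm_sub_rev]
    simp

theorem negLogKernel_classicalPoint [IsUltrametricDist C] (a : C) (x : BerkovichLine C) :
    negLogKernel hsiaKernel ((classicalPoint a : BerkovichLine C) : OnePoint (BerkovichLine C))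
      (x : OnePoint (BerkovichLine C)) = - Real.log (x (X - Polynomial.C a)) := by
  rw [negLogKernel_coe, hsiaKernel_classicalPoint]
  rintro rfl
  simp [hsiaKernel_classicalPoint, classicalPoint_apply]

/-- A function on the projective line is measurable if its restriction to the affine line is. -/
theorem measurable_onePoint {A : Type*} [TopologicalSpace A] [T1Space A] {f : OnePoint A → ℝ}
    (hf : @Measurable A ℝ (borel A) _ fun a => f a) : Measurable f := by
  let _ : MeasurableSpace A := borel A
  have : BorelSpace A := ⟨rfl⟩
  have hemb : MeasurableEmbedding ((↑) : A → OnePoint A) :=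
    OnePoint.isOpenEmbedding_coe.measurableEmbedding
  intro s hs
  -- The affine line is open in its compactification, and only the point at infinity is left over.
  have hsplit : f ⁻¹' s =
      (↑) '' ((fun a : A => f a) ⁻¹' s) ∪ (f ⁻¹' s ∩ {OnePoint.infty}) := by
    ext x
    induction x using OnePoint.rec <;> simp
  rw [hsplit]
  exact (hemb.measurableSet_image.2 (hf hs)).union
    (Set.subsingleton_singleton.anti Set.inter_subset_right).measurableSet

theorem measurable_negLogKernel_classicalPoint [IsUltrametricDist C] (a : C) :
    Measurable (negLogKernel hsiaKernel
      ((classicalPoint a : BerkovichLine C) : OnePoint (BerkovichLine C))) := by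
  refine measurable_onePoint ?_
  let _ : MeasurableSpace (BerkovichLine C) := borel _
  have : BorelSpace (BerkovichLine C) := ⟨rfl⟩
  simp only [negLogKernel_classicalPoint]
  exact (Real.measurable_log.comp (BerkovichLine.continuous_eval _).measurable).neg

theorem gaussNorm_X_sub_C {r : ℝ} (hr : 0 < r) (a : C) :
    (X - Polynomial.C a).gaussNorm (normAbs C) r = max r ‖a‖ := by
  refine le_antisymm ?_ (max_le ?_ ?_)
  · obtain ⟨i, hi⟩ := exists_eq_gaussNorm (normAbs C) r (X - Polynomial.C a)
    rw [hi]
    rcases i with _ | _ | i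
    · refine le_max_of_le_right ?_
      simp [normAbs]
    · refine le_max_of_le_left ?_
      simp [coeff_X]
    · have : (X - Polynomial.C a).coeff (i + 1 + 1) = 0 := by simp [coeff_X]
      rw [this]
      simp [hr.le]
  · have := le_gaussNorm (normAbs C) (X - Polynomial.C a) hr.le 1
    simpa [coeff_X, coeff_C] using this
  · have := le_gaussNorm (normAbs C) (X - Polynomial.C a) hr.le 0
    simpa [normAbs] using this

/-- The Gauss norm is a maximum of finitely many monomials in r. This gives the measurability of r ↦
ζ_{0,r}, by which the areal measure is a push-forward of the radial one. -/
theorem continuous_gaussNorm_Ioi (p : C[X]) :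
    Continuous fun r : Set.Ioi (0 : ℝ) => p.gaussNorm (normAbs C) r := by
  simp only [gaussNorm]
  split_ifs with h
  · exact Continuous.finset_sup'_apply h fun i _ => by fun_prop
  · exact continuous_const

variable [IsUltrametricDist C]

theorem discPoint_X_sub_C {r : ℝ} (hr : 0 < r) (a : C) :
    (discPoint r : BerkovichLine C) (X - Polynomial.C a) = max r ‖a‖ := by
  rw [discPoint, dif_pos hr]
  exact gaussNorm_X_sub_C hr a

theorem measurable_discPoint_coe :
    Measurable fun r : ℝ => ((discPoint r : BerkovichLine C) : OnePoint (BerkovichLine C)) := by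
  refine measurable_of_restrict_of_restrict_compl (s := Set.Ioi 0) measurableSet_Ioi ?_ ?_
  · have hcont : Continuous fun r : Set.Ioi (0 : ℝ) => (gaussPoint r.1 r.2 : BerkovichLine C) :=
      continuous_induced_rng.2 (continuous_pi fun p => continuous_gaussNorm_Ioi p)
    have heq : (Set.Ioi (0 : ℝ)).domRestrict
        (fun r : ℝ => ((discPoint r : BerkovichLine C) : OnePoint (BerkovichLine C))) =
        fun r : Set.Ioi (0 : ℝ) => ((gaussPoint r.1 r.2 : BerkovichLine C) : OnePoint _) := by
      funext r
      simp [discPoint, Set.mem_Ioi.1 r.2]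
    rw [heq]
    exact (OnePoint.continuous_coe.comp hcont).measurable
  · have heq : ((Set.Ioi (0 : ℝ))ᶜ).domRestrict
        (fun r : ℝ => ((discPoint r : BerkovichLine C) : OnePoint (BerkovichLine C))) =
        fun _ => ((classicalPoint 0 : BerkovichLine C) : OnePoint _) := by
      funext r
      have hr : ¬ (0 : ℝ) < r.1 := r.2
      simp [discPoint, hr]
    rw [heq]
    exact measurable_const

theorem integral_berkovichCircle {r : ℝ} (hr : 0 < r) (a : C) :
    ∫ w, negLogKernel hsiaKernel ((classicalPoint a : BerkovichLine C) : OnePoint _) w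
      ∂(berkovichCircle C r) = - Real.log (max r ‖a‖) := by
  rw [berkovichCircle, integral_dirac, negLogKernel_classicalPoint, discPoint_X_sub_C hr]

theorem integrable_berkovichCircle (r : ℝ) (f : OnePoint (BerkovichLine C) → ℝ) :
    Integrable f (berkovichCircle C r) :=
  integrable_dirac (by simp)

theorem arealMeasure_berkovichCircle (R : ℝ) :
    arealMeasure (berkovichCircle C) R =
      (radialMeasure R).map fun r => ((discPoint r : BerkovichLine C) : OnePoint _) :=
  Measure.bind_dirac_eq_map _ measurable_discPoint_coe

theorem negLogKernel_classicalPoint_discPoint_ae (a : C) :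
    (fun r => negLogKernel hsiaKernel ((classicalPoint a : BerkovichLine C) : OnePoint _)
      ((discPoint r : BerkovichLine C) : OnePoint (BerkovichLine C))) =ᵐ[radialMeasure 1]
      fun r => - Real.log (max r ‖a‖) := by
  filter_upwards [ae_radialMeasure_one] with r hr
  rw [negLogKernel_classicalPoint, discPoint_X_sub_C hr.1]

theorem integrable_arealMeasure_berkovichCircle (a : C) :
    Integrable (negLogKernel hsiaKernel ((classicalPoint a : BerkovichLine C) : OnePoint _))
      (arealMeasure (berkovichCircle C) 1) := by
  rw [arealMeasure_berkovichCircle, integrable_map_measure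
    (measurable_negLogKernel_classicalPoint a).aestronglyMeasurable
    measurable_discPoint_coe.aemeasurable]
  exact (integrable_log_max_radialMeasure (norm_nonneg a)).neg.congr
    (negLogKernel_classicalPoint_discPoint_ae a).symm

theorem integral_arealMeasure_berkovichCircle (a : C) :
    ∫ w, negLogKernel hsiaKernel ((classicalPoint a : BerkovichLine C) : OnePoint _) w
      ∂(arealMeasure (berkovichCircle C) 1) = - arealPotential ‖a‖ := by
  rw [arealMeasure_berkovichCircle, integral_map measurable_discPoint_coe.aemeasurable
    (measurable_negLogKernel_classicalPoint a).aestronglyMeasurable,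
    integral_congr_ae (negLogKernel_classicalPoint_discPoint_ae a), integral_neg,
    integral_log_max_radialMeasure (norm_nonneg a)]

end Berkovich

/-! ### The complex line -/

section Complex

theorem measurable_circle_coe (r : ℝ) :
    Measurable fun θ : ℝ => ((circleMap 0 r θ : ℂ) : OnePoint ℂ) :=
  (OnePoint.continuous_coe.comp (continuous_circleMap 0 r)).measurable

theorem negLogKernel_complex (a b : ℂ) :
    negLogKernel (fun z w : ℂ => ‖z - w‖) (a : OnePoint ℂ) (b : OnePoint ℂ) =
      - Real.log ‖a - b‖ :=
  negLogKernel_coe _ a b fun h => by simp [h]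

theorem measurable_negLogKernel_complex (a : ℂ) :
    Measurable (negLogKernel (fun z w : ℂ => ‖z - w‖) (a : OnePoint ℂ)) := by
  refine measurable_onePoint ?_
  simp only [negLogKernel_complex]
  rw [← BorelSpace.measurable_eq (α := ℂ)]
  fun_prop

theorem integrable_complexCircle_iff {r : ℝ} {f : OnePoint ℂ → ℝ} (hf : Measurable f) :
    Integrable f (complexCircle r) ↔ CircleIntegrable (fun z : ℂ => f z) 0 r := by
  rw [complexCircle, integrable_smul_measure (ENNReal.inv_ne_zero.2 ENNReal.ofReal_ne_top) (by simp [Real.pi_pos]),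
    integrable_map_measure hf.aestronglyMeasurable (measurable_circle_coe r).aemeasurable,
    CircleIntegrable, intervalIntegrable_iff_integrableOn_Ioc_of_le Real.two_pi_pos.le]
  rfl

theorem integral_complexCircle {r : ℝ} {f : OnePoint ℂ → ℝ} (hf : Measurable f) :
    ∫ z, f z ∂(complexCircle r) = Real.circleAverage (fun z : ℂ => f z) 0 r := by
  rw [complexCircle, integral_smul_measure, integral_map (measurable_circle_coe r).aemeasurable
    hf.aestronglyMeasurable, Real.circleAverage_def,
    intervalIntegral.integral_of_le Real.two_pi_pos.le, ENNReal.toReal_inv,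
    ENNReal.toReal_ofReal Real.two_pi_pos.le]

/-- Jensen's formula gives log r + log⁺(|a| / r). The value is the one found at ζ_{0,r}, so infinite
and finite places share the same potentials. -/
theorem circleAverage_log_norm_sub {r : ℝ} (hr : 0 < r) (a : ℂ) :
    Real.circleAverage (fun z => Real.log ‖a - z‖) 0 r = Real.log (max r ‖a‖) := by
  have := circleAverage_log_norm_sub_const_eq_log_radius_add_posLog (a := a) (c := 0) hr.ne'
  simp only [norm_sub_rev a]
  rw [this, zero_sub, norm_neg, Real.posLog_eq_log_max_one (by positivity),
    ← Real.log_mul hr.ne' (by positivity), mul_max_of_nonneg _ _ hr.le, mul_one,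
    mul_inv_cancel_left₀ hr.ne']

theorem integrable_complexCircle (r : ℝ) (a : ℂ) :
    Integrable (negLogKernel (fun z w : ℂ => ‖z - w‖) (a : OnePoint ℂ)) (complexCircle r) := by
  rw [integrable_complexCircle_iff (measurable_negLogKernel_complex a)]
  simp only [negLogKernel_complex, norm_sub_rev a]
  exact (circleIntegrable_log_norm_sub_const r).neg

theorem integral_negLogKernel_complexCircle {r : ℝ} (hr : 0 < r) (a : ℂ) :
    ∫ w, negLogKernel (fun z w : ℂ => ‖z - w‖) (a : OnePoint ℂ) w ∂(complexCircle r) =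
      - Real.log (max r ‖a‖) := by
  rw [integral_complexCircle (measurable_negLogKernel_complex a)]
  simp only [negLogKernel_complex]
  rw [← circleAverage_log_norm_sub hr]
  rw [Real.circleAverage_def, Real.circleAverage_def, intervalIntegral.integral_neg, smul_neg]

/-- The mass of s is, up to a constant, the length of the section at r of a Borel set in the (r,
θ)-plane. Measurability in r is what makes the `bind` of circle measures a genuine mixture. -/
theorem measurable_complexCircle : Measurable complexCircle := by
  refine Measure.measurable_of_measurable_coe _ fun s hs => ?_
  have hc : Measurable fun p : ℝ × ℝ => ((circleMap 0 p.1 p.2 : ℂ) : OnePoint ℂ) := by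
    refine (OnePoint.continuous_coe.comp ?_).measurable
    unfold circleMap
    fun_prop
  have : ∀ r, complexCircle r s = (ENNReal.ofReal (2 * Real.pi))⁻¹ *
      (volume.restrict (Set.Ioc 0 (2 * Real.pi)))
        (Prod.mk r ⁻¹' ((fun p : ℝ × ℝ => ((circleMap 0 p.1 p.2 : ℂ) : OnePoint ℂ)) ⁻¹' s)) := by
    intro r
    rw [complexCircle, Measure.smul_apply, Measure.map_apply (measurable_circle_coe r) hs]
    rfl
  simp only [this]
  exact (measurable_measure_prodMk_left (hc hs)).const_mul _

instance isProbabilityMeasure_complexCircle (r : ℝ) : IsProbabilityMeasure (complexCircle r) := by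
  refine ⟨?_⟩
  rw [complexCircle, Measure.smul_apply, Measure.map_apply (measurable_circle_coe r)
    MeasurableSet.univ]
  simp only [Set.preimage_univ, Measure.restrict_apply MeasurableSet.univ, Set.univ_inter,
    Real.volume_Ioc, sub_zero, smul_eq_mul]
  exact ENNReal.inv_mul_cancel (by simp [Real.pi_pos]) ENNReal.ofReal_ne_top

/-- The circle measures as a Markov kernel. -/
def complexCircleKernel : ProbabilityTheory.Kernel ℝ (OnePoint ℂ) :=
  ⟨complexCircle, measurable_complexCircle⟩

instance : ProbabilityTheory.IsMarkovKernel complexCircleKernel :=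
  ⟨isProbabilityMeasure_complexCircle⟩

/-- With M = 1 + |a|, the number x = log|a - z| is at most M on the circle, hence |x| ≤ 2M - x. The
right side has a mean known from Jensen's formula, with a bound integrable in r. -/
theorem integral_abs_negLogKernel_complexCircle_le {r : ℝ} (hr : 0 < r) (hr1 : r ≤ 1) (a : ℂ) :
    ∫ w, ‖negLogKernel (fun z w : ℂ => ‖z - w‖) (a : OnePoint ℂ) w‖ ∂(complexCircle r) ≤
      2 * (1 + ‖a‖) - Real.log (max r ‖a‖) := by
  have hm := measurable_negLogKernel_complex a
  have hle : ∀ z ∈ Metric.sphere (0 : ℂ) |r|,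
      |Real.log ‖a - z‖| ≤ 2 * (1 + ‖a‖) - Real.log ‖a - z‖ := by
    intro z hz
    have hz' : ‖z‖ ≤ 1 := by
      rw [mem_sphere_zero_iff_norm, abs_of_pos hr] at hz
      exact hz.trans_le hr1
    have h1 : Real.log ‖a - z‖ ≤ 1 + ‖a‖ :=
      (Real.log_le_self (norm_nonneg _)).trans ((norm_sub_le a z).trans (by linarith))
    rw [abs_le]
    constructor <;> linarith [norm_nonneg a]
  have hI : CircleIntegrable (fun z => Real.log ‖a - z‖) 0 r := by
    simp only [norm_sub_rev a]
    exact circleIntegrable_log_norm_sub_const r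
  rw [integral_complexCircle hm.norm]
  simp only [negLogKernel_complex, norm_neg, Real.norm_eq_abs]
  refine (Real.circleAverage_mono hI.abs ((circleIntegrable_const _ _ _).sub hI) hle).trans ?_
  have := Real.circleAverage_sub (circleIntegrable_const (2 * (1 + ‖a‖)) 0 r) hI
  refine this.le.trans ?_
  rw [circleAverage_log_norm_sub hr, Real.circleAverage_const]

theorem integrable_arealMeasure_complexCircle (a : ℂ) :
    Integrable (negLogKernel (fun z w : ℂ => ‖z - w‖) (a : OnePoint ℂ))
      (arealMeasure complexCircle 1) := by
  have hm := measurable_negLogKernel_complex a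
  refine (Measure.integrable_comp_iff (μ := radialMeasure 1) (κ := complexCircleKernel)
    hm.aestronglyMeasurable).2 ⟨ae_of_all _ fun r => integrable_complexCircle r a, ?_⟩
  refine Integrable.mono' (g := fun r => 2 * (1 + ‖a‖) - Real.log (max r ‖a‖))
    ((integrable_const _).sub (integrable_log_max_radialMeasure (norm_nonneg a))) ?_ ?_
  · exact (hm.norm.stronglyMeasurable.integral_kernel
      (κ := complexCircleKernel)).aestronglyMeasurable
  · filter_upwards [ae_radialMeasure_one] with r hr
    rw [Real.norm_of_nonneg (integral_nonneg fun _ => norm_nonneg _)]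
    exact integral_abs_negLogKernel_complexCircle_le hr.1 hr.2.le a

theorem integral_arealMeasure_complexCircle (a : ℂ) :
    ∫ w, negLogKernel (fun z w : ℂ => ‖z - w‖) (a : OnePoint ℂ) w
      ∂(arealMeasure complexCircle 1) = - arealPotential ‖a‖ := by
  have hI : Integrable (negLogKernel (fun z w : ℂ => ‖z - w‖) (a : OnePoint ℂ))
      ((radialMeasure 1).bind complexCircleKernel) := integrable_arealMeasure_complexCircle a
  rw [Measure.comp_eq_comp_const_apply] at hI
  have h := ProbabilityTheory.Kernel.integral_comp hI
  rw [← Measure.comp_eq_comp_const_apply] at h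
  refine h.trans ?_
  rw [ProbabilityTheory.Kernel.const_apply]
  rw [← integral_log_max_radialMeasure (norm_nonneg a), ← integral_neg]
  refine integral_congr_ae ?_
  filter_upwards [ae_radialMeasure_one] with r hr
  exact integral_negLogKernel_complexCircle hr.1 a

end Complex

/-! ### The product formula and elements that are small at a single place -/

section Product

variable {K : Type*} [Field K] [NumberField K]

theorem hasFiniteMulSupport_adicAbv {x : K} (hx : x ≠ 0) :
    (fun v : HeightOneSpectrum (𝓞 K) => HeightOneSpectrum.adicAbv K v x).HasFiniteMulSupport := by
  have h := FinitePlace.hasFiniteMulSupport hx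
  refine (h.preimage
    (FinitePlace.equivHeightOneSpectrum.symm.injective.injOn)).subset fun v hv => ?_
  simp only [Set.mem_preimage, Function.mem_mulSupport] at hv ⊢
  rwa [FinitePlace.equivHeightOneSpectrum_symm_apply, FinitePlace.norm_embedding]

theorem finite_support_log_adicAbv {x : K} (hx : x ≠ 0) :
    (Function.support fun v : HeightOneSpectrum (𝓞 K) =>
      Real.log (HeightOneSpectrum.adicAbv K v x)).Finite := by
  refine (hasFiniteMulSupport_adicAbv hx).subset fun v hv => ?_
  rw [Function.mem_mulSupport]
  rintro h
  exact hv (by simp [h])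

theorem log_finprod {ι : Type*} {f : ι → ℝ} (hf : ∀ i, 0 < f i)
    (hfin : f.HasFiniteMulSupport) : Real.log (∏ᶠ i, f i) = ∑ᶠ i, Real.log (f i) := by
  have hfin' : (Function.mulSupport f).Finite := hfin
  rw [finprod_eq_prod_of_mulSupport_subset f (s := hfin'.toFinset) (by simp),
    finsum_eq_sum_of_support_subset _ (s := hfin'.toFinset), Real.log_prod fun i _ => (hf i).ne']
  intro i hi
  simp only [Set.Finite.coe_toFinset, Function.mem_mulSupport]
  rintro h
  exact hi (by simp [h])

theorem finsum_nonpos_of_forall {ι : Type*} {f : ι → ℝ} (hf : ∀ i, f i ≤ 0) : ∑ᶠ i, f i ≤ 0 :=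
  finsum_induction (· ≤ 0) le_rfl (fun _ _ => add_nonpos) hf

/-- The product formula in additive form. `adicAbv` already includes the local degree, so only the
infinite terms carry a weight. -/
theorem sum_log_add_finsum_log_eq_zero {x : K} (hx : x ≠ 0) :
    ∑ v : InfinitePlace K, (v.mult : ℝ) * Real.log (v x) +
      ∑ᶠ v : HeightOneSpectrum (𝓞 K), Real.log (HeightOneSpectrum.adicAbv K v x) = 0 := by
  have hpos : ∀ v : HeightOneSpectrum (𝓞 K), 0 < HeightOneSpectrum.adicAbv K v x :=
    fun v => (HeightOneSpectrum.adicAbv K v).pos hx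
  have h := prod_abs_eq_one hx
  rw [← finprod_comp_equiv FinitePlace.equivHeightOneSpectrum.symm] at h
  simp only [FinitePlace.equivHeightOneSpectrum_symm_apply, FinitePlace.norm_embedding] at h
  have h' := congrArg Real.log h
  have hv : ∀ v : InfinitePlace K, 0 < v x := fun v => InfinitePlace.pos_iff.2 hx
  rw [Real.log_mul (Finset.prod_pos fun v _ => pow_pos (hv v) _).ne', Real.log_one,
    log_finprod hpos (hasFiniteMulSupport_adicAbv hx),
    Real.log_prod fun v _ => (pow_pos (hv v) _).ne'] at h'
  · simpa only [Real.log_pow] using h'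
  · intro h0
    rw [h0, mul_zero] at h
    exact zero_ne_one h

theorem adicAbv_le_one (v : HeightOneSpectrum (𝓞 K)) (x : 𝓞 K) :
    HeightOneSpectrum.adicAbv K v (x : K) ≤ 1 := by
  rw [← FinitePlace.norm_embedding]
  exact FinitePlace.norm_le_one K v x

theorem adicAbv_eq_one_iff (v : HeightOneSpectrum (𝓞 K)) (x : 𝓞 K) :
    HeightOneSpectrum.adicAbv K v (x : K) = 1 ↔ x ∉ v.asIdeal := by
  rw [← FinitePlace.norm_embedding]
  exact FinitePlace.norm_eq_one_iff_notMem K v x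

theorem adicAbv_lt_one_iff (v : HeightOneSpectrum (𝓞 K)) (x : 𝓞 K) :
    HeightOneSpectrum.adicAbv K v (x : K) < 1 ↔ x ∈ v.asIdeal := by
  rw [← FinitePlace.norm_embedding]
  exact FinitePlace.norm_lt_one_iff_mem K v x

/-- Some nonzero integer of `K` has prescribed small sizes at the infinite places, if the product
of the sizes is large enough. -/
theorem exists_minkowski_bound (K : Type*) [Field K] [NumberField K] :
    ∃ B : ℝ, ∀ f : InfinitePlace K → NNReal, B ≤ ∏ w, (f w : ℝ) ^ w.mult →
      ∃ a : 𝓞 K, a ≠ 0 ∧ ∀ w : InfinitePlace K, w (a : K) < f w := by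
  classical
  obtain ⟨B, hB⟩ : ∃ B : ℕ, mixedEmbedding.minkowskiBound K 1 <
      B * (mixedEmbedding.convexBodyLTFactor K) :=
    ENNReal.exists_nat_mul_gt (ENNReal.coe_ne_zero.mpr (mixedEmbedding.convexBodyLTFactor_ne_zero K))
      (ne_of_lt (mixedEmbedding.minkowskiBound_lt_top K 1))
  refine ⟨B, fun f hf => ?_⟩
  refine mixedEmbedding.exists_ne_zero_mem_ringOfIntegers_lt K (f := f) (hB.trans_le ?_)
  rw [mixedEmbedding.convexBodyLT_volume, mul_comm]
  gcongr
  have : (B : NNReal) ≤ ∏ w, (f w) ^ w.mult := by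
    rw [← NNReal.coe_le_coe]
    push_cast
    exact hf
  exact_mod_cast this

/-- Some power of a prime is principal. -/
theorem exists_generator_prime_pow (v : HeightOneSpectrum (𝓞 K)) :
    ∃ p : 𝓞 K, p ≠ 0 ∧ p ∈ v.asIdeal ∧ ∀ w : HeightOneSpectrum (𝓞 K), w ≠ v → p ∉ w.asIdeal := by
  let I : nonZeroDivisors (Ideal (𝓞 K)) := ⟨v.asIdeal, mem_nonZeroDivisors_of_ne_zero v.ne_bot⟩
  have hn : 0 < Fintype.card (ClassGroup (𝓞 K)) := Fintype.card_pos
  set n := Fintype.card (ClassGroup (𝓞 K))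
  have h1 : ClassGroup.mk0 (I ^ n) = 1 := by
    rw [map_pow]
    exact pow_card_eq_one
  have h2 : (v.asIdeal ^ n).IsPrincipal := (ClassGroup.mk0_eq_one_iff (I ^ n).2).1 h1
  obtain ⟨p, hp⟩ := h2
  have hp' : v.asIdeal ^ n = Ideal.span {p} := hp
  refine ⟨p, ?_, ?_, fun w hw hpw => ?_⟩
  · rintro rfl
    rw [Ideal.span_singleton_eq_bot.2 rfl] at hp'
    exact pow_ne_zero n v.ne_bot hp'
  · have : p ∈ v.asIdeal ^ n := hp' ▸ Ideal.mem_span_singleton_self p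
    exact Ideal.pow_le_self hn.ne' this
  · have hle : v.asIdeal ^ n ≤ w.asIdeal := hp' ▸ (Ideal.span_singleton_le_iff_mem _).2 hpw
    have hle' : v.asIdeal ≤ w.asIdeal := (Ideal.IsPrime.pow_le_iff hn.ne').1 hle
    exact hw (HeightOneSpectrum.ext (v.isMaximal.eq_of_le w.isPrime.ne_top hle').symm)

/-- Let p generate a power of the prime v. The product formula makes its archimedean product exceed
1, so for large m a nonzero integer a satisfies |a|_w < |p|_w^m at all infinite w. Then a / p^m is
less than 1 at infinity and integral away from v, and the product formula forces it to be large at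
v. -/
theorem exists_large_only_at_finite (v : HeightOneSpectrum (𝓞 K)) :
    ∃ x : K, x ≠ 0 ∧ (∀ w : InfinitePlace K, w x ≤ 1) ∧
      (∀ w : HeightOneSpectrum (𝓞 K), w ≠ v → HeightOneSpectrum.adicAbv K w x ≤ 1) ∧
      1 < HeightOneSpectrum.adicAbv K v x := by
  obtain ⟨p, hp0, hpv, hpw⟩ := exists_generator_prime_pow v
  obtain ⟨B, hB⟩ := exists_minkowski_bound K
  have hpK : (p : K) ≠ 0 := RingOfIntegers.coe_ne_zero_iff.2 hp0
  have hpos : ∀ w : InfinitePlace K, 0 < w (p : K) := fun w => InfinitePlace.pos_iff.2 hpK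
  have hP : 1 < ∏ w : InfinitePlace K, w (p : K) ^ w.mult := by
    have hprod := sum_log_add_finsum_log_eq_zero hpK
    rw [finsum_eq_single _ v fun w hw => by rw [(adicAbv_eq_one_iff w p).2 (hpw w hw),
      Real.log_one]] at hprod
    have hlt : Real.log (HeightOneSpectrum.adicAbv K v p) < 0 :=
      Real.log_neg ((HeightOneSpectrum.adicAbv K v).pos hpK) ((adicAbv_lt_one_iff v p).2 hpv)
    rw [← Real.log_pos_iff (Finset.prod_nonneg fun w _ => pow_nonneg (hpos w).le _),
      Real.log_prod fun w _ => (pow_pos (hpos w) _).ne']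
    simp only [Real.log_pow]
    linarith
  obtain ⟨m, hm⟩ := pow_unbounded_of_one_lt B hP
  obtain ⟨a, ha0, ha⟩ := hB (fun w => ⟨w (p : K) ^ m, pow_nonneg (hpos w).le _⟩) (by
    refine hm.le.trans (le_of_eq ?_)
    rw [← Finset.prod_pow]
    refine Finset.prod_congr rfl fun w _ => ?_
    change _ = (w (p : K) ^ m) ^ w.mult
    rw [← pow_mul, ← pow_mul, mul_comm])
  have haK : (a : K) ≠ 0 := RingOfIntegers.coe_ne_zero_iff.2 ha0
  have hx0 : (a : K) / (p : K) ^ m ≠ 0 := div_ne_zero haK (pow_ne_zero _ hpK)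
  have hinf : ∀ w : InfinitePlace K, w ((a : K) / (p : K) ^ m) < 1 := by
    intro w
    rw [map_div₀, map_pow, div_lt_one (pow_pos (hpos w) _)]
    exact ha w
  have hfin : ∀ w : HeightOneSpectrum (𝓞 K), w ≠ v →
      HeightOneSpectrum.adicAbv K w ((a : K) / (p : K) ^ m) ≤ 1 := by
    intro w hw
    rw [map_div₀, map_pow, (adicAbv_eq_one_iff w p).2 (hpw w hw), one_pow, div_one]
    exact adicAbv_le_one w a
  refine ⟨_, hx0, fun w => (hinf w).le, hfin, ?_⟩
  by_contra hcon
  have hall : ∀ w : HeightOneSpectrum (𝓞 K),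
      HeightOneSpectrum.adicAbv K w ((a : K) / (p : K) ^ m) ≤ 1 := by
    intro w
    by_cases hw : w = v
    · exact hw ▸ not_lt.1 hcon
    · exact hfin w hw
  have h1 : ∑ w : InfinitePlace K, (w.mult : ℝ) * Real.log (w ((a : K) / (p : K) ^ m)) < 0 :=
    Finset.sum_neg (fun w _ => mul_neg_of_pos_of_neg (Nat.cast_pos.2 w.mult_pos)
      (Real.log_neg (InfinitePlace.pos_iff.2 hx0) (hinf w))) Finset.univ_nonempty
  have h2 : ∑ᶠ w : HeightOneSpectrum (𝓞 K),
      Real.log (HeightOneSpectrum.adicAbv K w ((a : K) / (p : K) ^ m)) ≤ 0 :=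
    finsum_nonpos_of_forall fun w => Real.log_nonpos (apply_nonneg _ _) (hall w)
  linarith [sum_log_add_finsum_log_eq_zero hx0]

/-- Take twice an integer a that is smaller than 1/2 at the other infinite places. Since 2 is not a
unit, the finite part of the product formula for 2a is strictly negative, which gives a strict
inequality at v even when v is the only infinite place. -/
theorem exists_large_only_at_infinite (v : InfinitePlace K) :
    ∃ x : K, x ≠ 0 ∧ (∀ w : InfinitePlace K, w ≠ v → w x ≤ 1) ∧
      (∀ w : HeightOneSpectrum (𝓞 K), HeightOneSpectrum.adicAbv K w x ≤ 1) ∧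
      1 < v x := by
  classical
  obtain ⟨B, hB⟩ := exists_minkowski_bound K
  have hw2 : ∀ w : InfinitePlace K, w (2 : K) = 2 := fun w => by
    have h := w.norm_embedding_eq 2
    rw [map_ofNat] at h
    rw [← h]
    exact Complex.norm_ofNat 2
  set P : NNReal := ∏ w ∈ Finset.univ.erase v, (1 / 2 : NNReal) ^ w.mult with hP
  have hPpos : 0 < P := Finset.prod_pos fun w _ => by positivity
  -- The quotient makes the box large enough for Minkowski's bound; the summand 1 ensures M ≤ M ^
  -- mult.
  set M : NNReal := 1 + (Real.toNNReal B) / P with hM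
  obtain ⟨a, ha0, ha⟩ := hB (fun w => if w = v then M else 1 / 2) (by
    rw [← Finset.mul_prod_erase _ _ (Finset.mem_univ v), if_pos rfl]
    have hcongr : ∏ w ∈ Finset.univ.erase v,
        (((if w = v then M else 1 / 2 : NNReal)) : ℝ) ^ w.mult = P := by
      rw [hP, NNReal.coe_prod]
      refine Finset.prod_congr rfl fun w hw => ?_
      rw [if_neg (Finset.ne_of_mem_erase hw), NNReal.coe_pow]
    rw [hcongr]
    have h1 : M ≤ M ^ v.mult := le_self_pow₀ (by simp [hM]) v.mult_pos.ne'
    have h2 : Real.toNNReal B ≤ M ^ v.mult * P := by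
      calc Real.toNNReal B = (Real.toNNReal B) / P * P := (div_mul_cancel₀ _ hPpos.ne').symm
        _ ≤ M ^ v.mult * P := by
          gcongr
          exact le_trans (by simp [hM]) h1
    exact (Real.le_coe_toNNReal B).trans (by exact_mod_cast h2))
  have haK : (a : K) ≠ 0 := RingOfIntegers.coe_ne_zero_iff.2 ha0
  have h20 : (2 : K) ≠ 0 := two_ne_zero
  have hx0 : 2 * (a : K) ≠ 0 := mul_ne_zero h20 haK
  have hinf : ∀ w : InfinitePlace K, w ≠ v → w (2 * (a : K)) ≤ 1 := by
    intro w hw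
    have := ha w
    simp only [if_neg hw] at this
    rw [map_mul, hw2]
    push_cast at this
    linarith
  have h2int : ∀ w : HeightOneSpectrum (𝓞 K), HeightOneSpectrum.adicAbv K w (2 : K) ≤ 1 :=
    fun w => adicAbv_le_one w 2
  refine ⟨2 * a, hx0, hinf, fun w => ?_, ?_⟩
  · rw [map_mul]
    exact mul_le_one₀ (h2int w) (apply_nonneg _ _) (adicAbv_le_one w a)
  · have e1 : ∑ᶠ w : HeightOneSpectrum (𝓞 K), Real.log (HeightOneSpectrum.adicAbv K w (2 * a)) < 0 := by
      simp only [map_mul]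
      rw [finsum_congr fun w => Real.log_mul ((HeightOneSpectrum.adicAbv K w).pos h20).ne'
        ((HeightOneSpectrum.adicAbv K w).pos haK).ne',
        finsum_add_distrib (finite_support_log_adicAbv h20) (finite_support_log_adicAbv haK)]
      have e2 := sum_log_add_finsum_log_eq_zero h20
      have e3 : 0 < ∑ w : InfinitePlace K, (w.mult : ℝ) * Real.log (w (2 : K)) := by
        refine Finset.sum_pos (fun w _ => mul_pos (Nat.cast_pos.2 w.mult_pos) ?_)
          Finset.univ_nonempty
        rw [hw2]
        exact Real.log_pos one_lt_two
      have e4 : ∑ᶠ w : HeightOneSpectrum (𝓞 K), Real.log (HeightOneSpectrum.adicAbv K w a) ≤ 0 :=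
        finsum_nonpos_of_forall fun w => Real.log_nonpos (apply_nonneg _ _) (adicAbv_le_one w a)
      linarith
    have e5 := sum_log_add_finsum_log_eq_zero hx0
    rw [← Finset.add_sum_erase _ _ (Finset.mem_univ v)] at e5
    have e6 : ∑ w ∈ Finset.univ.erase v, (w.mult : ℝ) * Real.log (w (2 * (a : K))) ≤ 0 :=
      Finset.sum_nonpos fun w hw => mul_nonpos_of_nonneg_of_nonpos (Nat.cast_nonneg _)
        (Real.log_nonpos (apply_nonneg _ _) (hinf w (Finset.ne_of_mem_erase hw)))
    have e7 : 0 < (v.mult : ℝ) * Real.log (v (2 * (a : K))) := by linarith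
    rw [← Real.log_pos_iff (apply_nonneg _ _)]
    exact pos_of_mul_pos_right e7 (Nat.cast_nonneg _)

end Product

/-! ### Products over conjugates -/

section Conjugates

variable {K : Type*} [Field K]

theorem algEquiv_mem_conjSet_iff (τ : AlgebraicClosure K ≃ₐ[K] AlgebraicClosure K)
    (a b : AlgebraicClosure K) : b ∈ conjSet a ↔ τ b ∈ conjSet a := by
  rw [mem_conjSet, mem_conjSet, aeval_algHom_apply, map_eq_zero_iff τ τ.injective]

/-- Automorphisms permute the conjugates, so equivariance of φ makes the product Galois invariant.
-/
theorem prod_conjSet_mem_range [CharZero K] (a : AlgebraicClosure K)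
    (φ : AlgebraicClosure K → AlgebraicClosure K)
    (hφ : ∀ (τ : AlgebraicClosure K ≃ₐ[K] AlgebraicClosure K) (b : AlgebraicClosure K),
      τ (φ b) = φ (τ b)) :
    ∃ x : K, algebraMap K (AlgebraicClosure K) x = ∏ b ∈ conjSet a, φ b := by
  refine (InfiniteGalois.mem_range_algebraMap_iff_fixed _).2 fun τ => ?_
  rw [map_prod]
  exact Finset.prod_equiv τ.toEquiv (fun b => algEquiv_mem_conjSet_iff τ a b) fun b _ => hφ τ b

theorem zero_notMem_conjSet {a b : AlgebraicClosure K} (ha : a ≠ 0) (hb : b ∈ conjSet a) :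
    b ≠ 0 := by
  rintro rfl
  rw [mem_conjSet, aeval_def, eval₂_at_zero] at hb
  have h0 : (minpoly K a).coeff 0 = 0 := by simpa using hb
  exact minpoly.coeff_zero_ne_zero (Algebra.IsIntegral.isIntegral a) ha h0

/-- The product of the conjugates. One x serves all embeddings s, which is what allows the product
formula to be applied afterwards. -/
theorem exists_sum_log_conjSet [CharZero K] {a : AlgebraicClosure K} (ha : a ≠ 0) :
    ∃ x : K, x ≠ 0 ∧ ∀ {L : Type} [NormedField L] (s : AlgebraicClosure K →+* L),
      ∑ b ∈ conjSet a, Real.log ‖s b‖ = Real.log ‖s (algebraMap K _ x)‖ := by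
  obtain ⟨x, hx⟩ := prod_conjSet_mem_range a id fun _ _ => rfl
  refine ⟨x, ?_, fun s => ?_⟩
  · rintro rfl
    rw [map_zero] at hx
    exact Finset.prod_ne_zero_iff.2 (fun b hb => zero_notMem_conjSet ha hb) hx.symm
  · rw [hx, map_prod, norm_prod, Real.log_prod]
    · rfl
    · intro b hb
      simpa using zero_notMem_conjSet ha hb

/-- Up to sign, x is the discriminant of the minimal polynomial. Diagonal factors are replaced by 1,
consistently with `Real.log 0 = 0`. -/
theorem exists_sum_log_conjSet_sub [CharZero K] (a : AlgebraicClosure K) :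
    ∃ x : K, x ≠ 0 ∧ ∀ {L : Type} [NormedField L] (s : AlgebraicClosure K →+* L),
      ∑ b ∈ conjSet a, ∑ c ∈ conjSet a, Real.log ‖s (b - c)‖ =
        Real.log ‖s (algebraMap K _ x)‖ := by
  classical
  obtain ⟨x, hx⟩ := prod_conjSet_mem_range a
    (fun b => ∏ c ∈ conjSet a, if b = c then 1 else b - c) fun τ b => by
      rw [map_prod]
      refine Finset.prod_equiv τ.toEquiv (fun c => algEquiv_mem_conjSet_iff τ a c) fun c _ => ?_
      change τ (if b = c then 1 else b - c) = if τ b = τ c then 1 else τ b - τ c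
      rw [τ.injective.eq_iff]
      split_ifs <;> simp
  have hne : ∀ b c : AlgebraicClosure K, (if b = c then 1 else b - c) ≠ 0 := by
    intro b c
    split_ifs with h
    · exact one_ne_zero
    · exact sub_ne_zero.2 h
  refine ⟨x, ?_, fun s => ?_⟩
  · rintro rfl
    rw [map_zero] at hx
    exact Finset.prod_ne_zero_iff.2
      (fun b _ => Finset.prod_ne_zero_iff.2 fun c _ => hne b c) hx.symm
  · rw [hx, map_prod, norm_prod, Real.log_prod]
    · refine Finset.sum_congr rfl fun b _ => ?_
      rw [map_prod, norm_prod, Real.log_prod]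
      · refine Finset.sum_congr rfl fun c _ => ?_
        split_ifs with h
        · simp [h]
        · rfl
      · intro c _
        simpa using hne b c
    · intro b _
      rw [norm_ne_zero_iff, _root_.map_ne_zero]
      exact Finset.prod_ne_zero_iff.2 fun c _ => hne b c

/-- Over an ultrametric field, the roots of a polynomial with integral coefficients and unit
constant coefficient are not small. -/
theorem one_le_norm_of_root {L : Type*} [NormedField L] [IsUltrametricDist L] {p : L[X]}
    (hp : ∀ i, ‖p.coeff i‖ ≤ 1) (hp0 : ‖p.coeff 0‖ = 1) {b : L} (hb : p.eval b = 0) :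
    1 ≤ ‖b‖ := by
  by_contra! hlt
  have hdiv : ‖p.divX.eval b‖ ≤ 1 := by
    rw [eval_eq_sum_range]
    refine IsUltrametricDist.norm_sum_le_of_forall_le_of_nonneg zero_le_one fun i _ => ?_
    rw [norm_mul, norm_pow, coeff_divX]
    exact mul_le_one₀ (hp _) (by positivity) (pow_le_one₀ (norm_nonneg _) hlt.le)
  have h0 : p.coeff 0 = - (p.divX.eval b * b) := by
    have := congrArg (eval b) (divX_mul_X_add p)
    rw [hb] at this
    simp only [eval_add, eval_mul, eval_X, eval_C] at this
    linear_combination this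
  rw [h0, norm_neg, norm_mul] at hp0
  have : ‖p.divX.eval b‖ * ‖b‖ ≤ 1 * ‖b‖ := by gcongr
  linarith

end Conjugates

/-! ### The height of a point -/

section Height

variable {K : Type*} [Field K]

open Classical in
/-- The negative `t ↦ - ∫ - log |z - w| dρ_v(w)`, `|z| = t`, of the potential of the areal measure
of radius one or of the standard measure. -/
def localPotential (S : Finset (Place K)) (w : Place K) (t : ℝ) : ℝ :=
  if w ∈ S then arealPotential t else Real.posLog t

/-- The excess of the local potential over the logarithm. -/
def localDefect (S : Finset (Place K)) (w : Place K) (t : ℝ) : ℝ :=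
  localPotential S w t - Real.log t

/-- Outside the unit disc both kinds of measure have the potential of a point mass at 0; here the
radius being 1 matters. -/
theorem localDefect_of_one_le (S : Finset (Place K)) (w : Place K) {t : ℝ} (ht : 1 ≤ t) :
    localDefect S w t = 0 := by
  rw [localDefect, localPotential, arealPotential, if_neg (not_lt.2 ht),
    Real.posLog_eq_log (by rwa [abs_of_nonneg (zero_le_one.trans ht)]), ite_self, sub_self]

theorem localDefect_eq_of_mem {S : Finset (Place K)} {w : Place K} (hw : w ∈ S) {t : ℝ}
    (ht : t < 1) : localDefect S w t = (t ^ 2 - 1) / 2 - Real.log t := by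
  rw [localDefect, localPotential, if_pos hw, arealPotential, if_pos ht]

theorem localDefect_pos_of_mem {S : Finset (Place K)} {w : Place K} (hw : w ∈ S) {t : ℝ}
    (ht0 : 0 < t) (ht : t < 1) : 0 < localDefect S w t := by
  rw [localDefect_eq_of_mem hw ht]
  exact arealDefect_pos ht0 ht

theorem localDefect_nonneg (S : Finset (Place K)) (w : Place K) {t : ℝ} (ht0 : 0 < t) :
    0 ≤ localDefect S w t := by
  rcases le_or_gt 1 t with ht | ht
  · rw [localDefect_of_one_le S w ht]
  · by_cases hw : w ∈ S
    · exact (localDefect_pos_of_mem hw ht0 ht).le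
    · rw [localDefect, localPotential, if_neg hw]
      linarith [Real.posLog_nonneg (x := t), Real.log_neg ht0 ht]

variable (S : Finset (Place K))

theorem integrable_arealFamily_inf (v : InfinitePlace K) (a : ℂ) :
    Integrable (negLogKernel (fun z w : ℂ => ‖z - w‖) (a : OnePoint ℂ))
      ((arealFamily S fun _ => 1).inf v) := by
  simp only [arealFamily]
  split_ifs
  · exact integrable_arealMeasure_complexCircle a
  · exact integrable_complexCircle 1 a

theorem integral_arealFamily_inf (v : InfinitePlace K) (a : ℂ) :
    ∫ w, negLogKernel (fun z w : ℂ => ‖z - w‖) (a : OnePoint ℂ) w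
      ∂((arealFamily S fun _ => 1).inf v) = - localPotential S (Sum.inl v) ‖a‖ := by
  simp only [arealFamily, localPotential]
  split_ifs
  · exact integral_arealMeasure_complexCircle a
  · rw [integral_negLogKernel_complexCircle one_pos, posLog_eq_log_max _ (norm_nonneg a)]

theorem integrable_arealFamily_fin (v : HeightOneSpectrum (𝓞 K)) (a : ℂ_[residueChar v]) :
    Integrable (negLogKernel hsiaKernel ((classicalPoint a : BerkovichLine _) : OnePoint _))
      ((arealFamily S fun _ => 1).fin v) := by
  simp only [arealFamily]
  split_ifs
  · exact integrable_arealMeasure_berkovichCircle a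
  · exact integrable_berkovichCircle 1 _

theorem integral_arealFamily_fin (v : HeightOneSpectrum (𝓞 K)) (a : ℂ_[residueChar v]) :
    ∫ w, negLogKernel hsiaKernel ((classicalPoint a : BerkovichLine _) : OnePoint _) w
      ∂((arealFamily S fun _ => 1).fin v) = - localPotential S (Sum.inr v) ‖a‖ := by
  simp only [arealFamily, localPotential]
  split_ifs
  · exact integral_arealMeasure_berkovichCircle a
  · rw [integral_berkovichCircle one_pos, posLog_eq_log_max _ (norm_nonneg a)]

theorem energy_arealFamily_fin_of_notMem {v : HeightOneSpectrum (𝓞 K)} (hv : Sum.inr v ∉ S) :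
    energy hsiaKernel ((arealFamily S fun _ => 1).fin v) ((arealFamily S fun _ => 1).fin v) = 0 := by
  simp only [arealFamily, if_neg hv]
  exact energy_dirac_self _ _

variable [NumberField K]

/-- If the degree had the default value 0, the exponent in `finiteAbs` would be 0 and 0 ^ 0 = 1
would be the norm of 0. -/
theorem finiteLocalDegree_pos (σ : PlaceEmbeddings K) (v : HeightOneSpectrum (𝓞 K)) : 0 < finiteLocalDegree v := by
  refine Nat.pos_of_ne_zero fun h => ?_
  have := σ.norm_fin v 0
  simp [finiteAbs, h] at this

variable (σ : PlaceEmbeddings K)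

theorem finiteLocalDegree_mul_log (v : HeightOneSpectrum (𝓞 K)) {x : K} (hx : x ≠ 0) :
    (finiteLocalDegree v : ℝ) * Real.log ‖σ.fin v (algebraMap K _ x)‖ =
      Real.log (HeightOneSpectrum.adicAbv K v x) := by
  rw [σ.norm_fin, finiteAbs, Real.log_rpow ((HeightOneSpectrum.adicAbv K v).pos hx),
    mul_inv_cancel_left₀ (Nat.cast_pos.2 (finiteLocalDegree_pos σ v)).ne']

theorem norm_fin_le_one_iff (v : HeightOneSpectrum (𝓞 K)) (x : K) :
    ‖σ.fin v (algebraMap K _ x)‖ ≤ 1 ↔ HeightOneSpectrum.adicAbv K v x ≤ 1 := by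
  have hpos : (0 : ℝ) < (finiteLocalDegree v : ℝ)⁻¹ :=
    inv_pos.2 (Nat.cast_pos.2 (finiteLocalDegree_pos σ v))
  rw [σ.norm_fin, finiteAbs]
  nth_rw 1 [← Real.one_rpow (finiteLocalDegree v : ℝ)⁻¹]
  exact Real.rpow_le_rpow_iff (apply_nonneg _ _) zero_le_one hpos

theorem norm_fin_eq_one_of_adicAbv_eq_one {v : HeightOneSpectrum (𝓞 K)} {x : K}
    (hx : HeightOneSpectrum.adicAbv K v x = 1) : ‖σ.fin v (algebraMap K _ x)‖ = 1 := by
  rw [σ.norm_fin, finiteAbs, hx, Real.one_rpow]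

/-- At almost all places, the conjugates of a nonzero algebraic number are not small. -/
theorem finite_setOf_norm_conj_lt_one {a : AlgebraicClosure K} (ha : a ≠ 0) :
    {v : HeightOneSpectrum (𝓞 K) | ∃ b ∈ conjSet a, ‖σ.fin v b‖ < 1}.Finite := by
  have hint : IsIntegral K a := Algebra.IsIntegral.isIntegral a
  -- Outside this finite set all nonzero coefficients of the minimal polynomial are units, the
  -- constant one included because a ≠ 0.
  have hfin : (⋃ i ∈ (minpoly K a).support, Function.mulSupport
      fun v : HeightOneSpectrum (𝓞 K) =>
        HeightOneSpectrum.adicAbv K v ((minpoly K a).coeff i)).Finite :=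
    Set.Finite.biUnion (Finset.finite_toSet _) fun i hi =>
      hasFiniteMulSupport_adicAbv (mem_support_iff.1 hi)
  refine hfin.subset fun v => ?_
  rintro ⟨b, hb, hlt⟩
  by_contra hv
  simp only [Set.mem_iUnion, Function.mem_mulSupport, not_exists, not_not] at hv
  have hcoeff : ∀ i ∈ (minpoly K a).support,
      ‖σ.fin v (algebraMap K _ ((minpoly K a).coeff i))‖ = 1 :=
    fun i hi => norm_fin_eq_one_of_adicAbv_eq_one σ (hv i hi)
  refine (not_le.2 hlt) (one_le_norm_of_root
    (p := (minpoly K a).map ((σ.fin v).comp (algebraMap K _))) (fun i => ?_) ?_ ?_)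
  · rw [coeff_map, RingHom.comp_apply]
    by_cases hi : i ∈ (minpoly K a).support
    · exact (hcoeff i hi).le
    · rw [notMem_support_iff.1 hi]
      simp
  · rw [coeff_map, RingHom.comp_apply]
    exact hcoeff 0 (mem_support_iff.2 (minpoly.coeff_zero_ne_zero hint ha))
  · rw [eval_map, ← hom_eval₂, ← aeval_def, mem_conjSet.1 hb, map_zero]

/-- The contribution of an infinite place to the height of `a`, up to the product formula. -/
def defectInf (v : InfinitePlace K) (a : AlgebraicClosure K) : ℝ :=
  (v.mult : ℝ) / (Module.finrank ℚ K : ℝ) *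
    (((conjSet a).card : ℝ)⁻¹ * ∑ b ∈ conjSet a, localDefect S (Sum.inl v) ‖σ.inf v b‖)

/-- The contribution of a finite place to the height of `a`, up to the product formula. -/
def defectFin (v : HeightOneSpectrum (𝓞 K)) (a : AlgebraicClosure K) : ℝ :=
  (finiteLocalDegree v : ℝ) / (Module.finrank ℚ K : ℝ) *
    (((conjSet a).card : ℝ)⁻¹ * ∑ b ∈ conjSet a, localDefect S (Sum.inr v) ‖σ.fin v b‖)

theorem finite_support_defectFin {a : AlgebraicClosure K} (ha : a ≠ 0) :
    (Function.support fun v => defectFin S σ v a).Finite := by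
  refine (finite_setOf_norm_conj_lt_one σ ha).subset fun v hv => ?_
  by_contra hcon
  simp only [Set.mem_ofPred_eq, not_exists, not_and, not_lt] at hcon
  refine hv ?_
  simp only [defectFin]
  rw [Finset.sum_eq_zero fun b hb => localDefect_of_one_le S _ (hcon b hb), mul_zero, mul_zero]

/-- Each potential is split as defect plus log|b|. The logarithms assemble into the terms in x and
y, which cancel only after summation over all places. -/
theorem energySub_inf_coe (v : InfinitePlace K) {a : AlgebraicClosure K} {x y : K}
    (hx : ∀ {L : Type} [NormedField L] (s : AlgebraicClosure K →+* L),
      ∑ b ∈ conjSet a, ∑ c ∈ conjSet a, Real.log ‖s (b - c)‖ = Real.log ‖s (algebraMap K _ x)‖)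
    (hy : ∀ {L : Type} [NormedField L] (s : AlgebraicClosure K →+* L),
      ∑ b ∈ conjSet a, Real.log ‖s b‖ = Real.log ‖s (algebraMap K _ y)‖) :
    (v.mult : ℝ) / (Module.finrank ℚ K : ℝ) * energySub (fun z w : ℂ => ‖z - w‖)
      ((arealFamily S fun _ => 1).inf v) ((pointFamily σ (a : OnePoint _)).inf v) =
    (v.mult : ℝ) / (Module.finrank ℚ K : ℝ) * energySub (fun z w : ℂ => ‖z - w‖)
      ((arealFamily S fun _ => 1).inf v) ((pointFamily σ OnePoint.infty).inf v) +
    2 * defectInf S σ v a +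
    (2 * ((conjSet a).card : ℝ)⁻¹ / (Module.finrank ℚ K : ℝ) * (v.mult * Real.log (v y)) -
    ((conjSet a).card : ℝ)⁻¹ ^ 2 / (Module.finrank ℚ K : ℝ) * (v.mult * Real.log (v x))) := by
  simp only [pointFamily]
  rw [energySub_infty, energySub_coe (fun z w => norm_sub_rev z w) (fun b => σ.inf v b) _
    (fun b => ‖σ.inf v b‖) (fun b => localPotential S (Sum.inl v) ‖σ.inf v b‖)
    (fun b c => by rw [negLogKernel_complex, map_sub])
    (fun b => integrable_arealFamily_inf S v _) (fun b => integral_arealFamily_inf S v _), hx,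
    σ.norm_inf, defectInf]
  simp only [localDefect]
  rw [Finset.sum_sub_distrib, hy, σ.norm_inf]
  ring

theorem energySub_fin_coe (v : HeightOneSpectrum (𝓞 K)) {a : AlgebraicClosure K} {x y : K}
    (hx0 : x ≠ 0) (hy0 : y ≠ 0)
    (hx : ∀ {L : Type} [NormedField L] (s : AlgebraicClosure K →+* L),
      ∑ b ∈ conjSet a, ∑ c ∈ conjSet a, Real.log ‖s (b - c)‖ = Real.log ‖s (algebraMap K _ x)‖)
    (hy : ∀ {L : Type} [NormedField L] (s : AlgebraicClosure K →+* L),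
      ∑ b ∈ conjSet a, Real.log ‖s b‖ = Real.log ‖s (algebraMap K _ y)‖) :
    (finiteLocalDegree v : ℝ) / (Module.finrank ℚ K : ℝ) * energySub hsiaKernel
      ((arealFamily S fun _ => 1).fin v) ((pointFamily σ (a : OnePoint _)).fin v) =
    (finiteLocalDegree v : ℝ) / (Module.finrank ℚ K : ℝ) * energySub hsiaKernel
      ((arealFamily S fun _ => 1).fin v) ((pointFamily σ OnePoint.infty).fin v) +
    2 * defectFin S σ v a +
    (2 * ((conjSet a).card : ℝ)⁻¹ / (Module.finrank ℚ K : ℝ) *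
      Real.log (HeightOneSpectrum.adicAbv K v y) -
    ((conjSet a).card : ℝ)⁻¹ ^ 2 / (Module.finrank ℚ K : ℝ) *
      Real.log (HeightOneSpectrum.adicAbv K v x)) := by
  simp only [pointFamily]
  rw [energySub_infty, energySub_coe hsiaKernel_comm (fun b => classicalPoint (σ.fin v b)) _
    (fun b => ‖σ.fin v b‖) (fun b => localPotential S (Sum.inr v) ‖σ.fin v b‖)
    (fun b c => by
      rw [negLogKernel_classicalPoint, classicalPoint_apply, map_sub, norm_sub_rev]
      simp)
    (fun b => integrable_arealFamily_fin S v _) (fun b => integral_arealFamily_fin S v _), hx,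
    defectFin, ← finiteLocalDegree_mul_log σ v hx0, ← finiteLocalDegree_mul_log σ v hy0]
  simp only [localDefect]
  rw [Finset.sum_sub_distrib, hy]
  ring

/-- Off S the measure is a single Dirac mass, whose energy is 0 without the diagonal. Finiteness is
required for `finsum` to be additive. -/
theorem finite_support_energySub_infty :
    (Function.support fun v : HeightOneSpectrum (𝓞 K) =>
      (finiteLocalDegree v : ℝ) / (Module.finrank ℚ K : ℝ) * energySub hsiaKernel
        ((arealFamily S fun _ => 1).fin v) ((pointFamily σ OnePoint.infty).fin v)).Finite := by
  refine (S.finite_toSet.preimage Sum.inr_injective.injOn).subset fun v hv => ?_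
  by_contra hvS
  refine hv ?_
  simp only [pointFamily]
  rw [energySub_infty, energy_arealFamily_fin_of_notMem S hvS, mul_zero]

/-- The height of a nonzero algebraic number as a sum of nonnegative local terms. -/
theorem adelicHeight_coe {a : AlgebraicClosure K} (ha : a ≠ 0) :
    adelicHeight σ (arealFamily S fun _ => 1) (a : OnePoint (AlgebraicClosure K)) =
      adelicHeight σ (arealFamily S fun _ => 1) OnePoint.infty +
      (∑ v, defectInf S σ v a + ∑ᶠ v, defectFin S σ v a) := by
  obtain ⟨x, hx0, hx⟩ := exists_sum_log_conjSet_sub a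
  obtain ⟨y, hy0, hy⟩ := exists_sum_log_conjSet ha
  have hfx : (Function.support fun v : HeightOneSpectrum (𝓞 K) =>
      ((conjSet a).card : ℝ)⁻¹ ^ 2 / (Module.finrank ℚ K : ℝ) *
        Real.log (HeightOneSpectrum.adicAbv K v x)).Finite :=
    (finite_support_log_adicAbv hx0).subset (Function.support_mul_subset_right _ _)
  have hfy : (Function.support fun v : HeightOneSpectrum (𝓞 K) =>
      2 * ((conjSet a).card : ℝ)⁻¹ / (Module.finrank ℚ K : ℝ) *
        Real.log (HeightOneSpectrum.adicAbv K v y)).Finite :=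
    (finite_support_log_adicAbv hy0).subset (Function.support_mul_subset_right _ _)
  have hfd : (Function.support fun v => 2 * defectFin S σ v a).Finite :=
    (finite_support_defectFin S σ ha).subset (Function.support_mul_subset_right _ _)
  have hfe := finite_support_energySub_infty S σ
  have hfed := (hfe.union hfd).subset (Function.support_add _ _)
  have hfxy := (hfy.union hfx).subset (Function.support_sub _ _)
  rw [adelicHeight, adelicHeight]
  simp only [energySub_inf_coe S σ _ hx hy, energySub_fin_coe S σ _ hx0 hy0 hx hy]
  rw [finsum_add_distrib hfed hfxy, finsum_add_distrib hfe hfd, finsum_sub_distrib hfy hfx,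
    ← mul_finsum, ← mul_finsum, ← mul_finsum,
    Finset.sum_add_distrib, Finset.sum_add_distrib, Finset.sum_sub_distrib, ← Finset.mul_sum,
    ← Finset.mul_sum, ← Finset.mul_sum]
  have px := sum_log_add_finsum_log_eq_zero hx0
  have py := sum_log_add_finsum_log_eq_zero hy0
  -- The product formula for y and x, with the weights left by the factor 1/2 of the height.
  linear_combination (((conjSet a).card : ℝ)⁻¹ / (Module.finrank ℚ K : ℝ)) * py -
    (1 / 2 * ((conjSet a).card : ℝ)⁻¹ ^ 2 / (Module.finrank ℚ K : ℝ)) * px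

theorem defectInf_nonneg (v : InfinitePlace K) {a : AlgebraicClosure K} (ha : a ≠ 0) :
    0 ≤ defectInf S σ v a := by
  refine mul_nonneg (by positivity) (mul_nonneg (by positivity) (Finset.sum_nonneg fun b hb => ?_))
  exact localDefect_nonneg S _ (norm_pos_iff.2 ((_root_.map_ne_zero _).2 (zero_notMem_conjSet ha hb)))

theorem defectFin_nonneg (v : HeightOneSpectrum (𝓞 K)) {a : AlgebraicClosure K} (ha : a ≠ 0) :
    0 ≤ defectFin S σ v a := by
  refine mul_nonneg (by positivity) (mul_nonneg (by positivity) (Finset.sum_nonneg fun b hb => ?_))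
  exact localDefect_nonneg S _ (norm_pos_iff.2 ((_root_.map_ne_zero _).2 (zero_notMem_conjSet ha hb)))

/-- Among the algebraic points, only `0` can have a height less than that of infinity. -/
theorem adelicHeight_infty_le {α : OnePoint (AlgebraicClosure K)}
    (hα : α ≠ ((0 : AlgebraicClosure K) : OnePoint (AlgebraicClosure K))) :
    adelicHeight σ (arealFamily S fun _ => 1) OnePoint.infty ≤
      adelicHeight σ (arealFamily S fun _ => 1) α := by
  induction α using OnePoint.rec with
  | infty => exact le_rfl
  | coe a =>
    have ha : a ≠ 0 := fun h => hα (by rw [h])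
    rw [adelicHeight_coe S σ ha]
    have h1 : 0 ≤ ∑ v, defectInf S σ v a :=
      Finset.sum_nonneg fun v _ => defectInf_nonneg S σ v ha
    have h2 : 0 ≤ ∑ᶠ v, defectFin S σ v a := finsum_nonneg fun v => defectFin_nonneg S σ v ha
    linarith

end Height

/-! ### Radicals of elements that are small at a single place -/

section Sequence

variable {K : Type*} [Field K]

theorem conj_pow_eq {n : ℕ} {c : K} {a b : AlgebraicClosure K}
    (ha : a ^ n = algebraMap K _ c) (hb : b ∈ conjSet a) : b ^ n = algebraMap K _ c := by
  have hdvd : minpoly K a ∣ X ^ n - Polynomial.C c := minpoly.dvd K a (by simp [ha])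
  obtain ⟨q, hq⟩ := hdvd
  have h := congrArg (aeval b) hq
  rw [map_mul, mem_conjSet.1 hb, zero_mul] at h
  simpa [sub_eq_zero] using h

theorem pointDegree_le_of_pow_eq {n : ℕ} (hn : n ≠ 0) {c : K} {a : AlgebraicClosure K}
    (ha : a ^ n = algebraMap K _ c) : pointDegree (a : OnePoint (AlgebraicClosure K)) ≤ n := by
  change Module.finrank K (IntermediateField.adjoin K {a}) ≤ n
  rw [IntermediateField.adjoin.finrank (Algebra.IsIntegral.isIntegral a)]
  have hdvd : minpoly K a ∣ X ^ n - Polynomial.C c := minpoly.dvd K a (by simp [ha])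
  exact (natDegree_le_of_dvd hdvd (X_pow_sub_C_ne_zero (Nat.pos_of_ne_zero hn) c)).trans_eq
    natDegree_X_pow_sub_C

theorem pointDegree_pos (α : OnePoint (AlgebraicClosure K)) : 0 < pointDegree α := by
  induction α using OnePoint.rec with
  | infty => exact one_pos
  | coe a =>
    change 0 < Module.finrank K (IntermediateField.adjoin K {a})
    have := IntermediateField.adjoin.finiteDimensional
      (Algebra.IsIntegral.isIntegral (R := K) a)
    exact Module.finrank_pos

theorem norm_conj_pow_eq {L : Type*} [NormedField L] (s : AlgebraicClosure K →+* L) {n : ℕ} {c : K}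
    {a b : AlgebraicClosure K} (ha : a ^ n = algebraMap K _ c) (hb : b ∈ conjSet a) :
    ‖s b‖ ^ n = ‖s (algebraMap K _ c)‖ := by
  rw [← norm_pow, ← map_pow, conj_pow_eq ha hb]

/-- The n-th powers of all conjugates equal c, so the conjugates have the same absolute value at
each place. -/
theorem average_conjSet_eq {L : Type*} [NormedField L] (s : AlgebraicClosure K →+* L) {n : ℕ}
    (hn : n ≠ 0) {c : K} {a : AlgebraicClosure K} (ha : a ^ n = algebraMap K _ c) (f : ℝ → ℝ) :
    ((conjSet a).card : ℝ)⁻¹ * ∑ b ∈ conjSet a, f ‖s b‖ = f ‖s a‖ := by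
  have h : ∀ b ∈ conjSet a, f ‖s b‖ = f ‖s a‖ := fun b hb => by
    rw [(pow_left_inj₀ (norm_nonneg _) (norm_nonneg _) hn).1 ((norm_conj_pow_eq s ha hb).trans
      (norm_conj_pow_eq s ha (self_mem_conjSet a)).symm)]
  have hcard : ((conjSet a).card : ℝ) ≠ 0 := Nat.cast_ne_zero.2 (card_conjSet_pos a).ne'
  rw [Finset.sum_congr rfl h, Finset.sum_const, nsmul_eq_mul, inv_mul_cancel_left₀ hcard]

theorem average_conjSet_localDefect_eq_zero {L : Type*} [NormedField L]
    (s : AlgebraicClosure K →+* L) (S : Finset (Place K)) (w : Place K) {n : ℕ}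
    (hn : n ≠ 0) {c : K} {a : AlgebraicClosure K} (ha : a ^ n = algebraMap K _ c)
    (hc : 1 ≤ ‖s (algebraMap K _ c)‖) :
    ((conjSet a).card : ℝ)⁻¹ * ∑ b ∈ conjSet a, localDefect S w ‖s b‖ = 0 := by
  rw [average_conjSet_eq s hn ha]
  refine localDefect_of_one_le S w ?_
  rw [← norm_conj_pow_eq s ha (self_mem_conjSet a)] at hc
  exact (one_le_pow_iff_of_nonneg (norm_nonneg _) hn).1 hc

variable [NumberField K]

/-- There is an element of `K` whose radicals have a height exceeding that of infinity only by a
local term at a place of `S`. -/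
theorem exists_adelicHeight_radical (σ : PlaceEmbeddings K) {S : Finset (Place K)}
    (hS : S.Nonempty) :
    ∃ (c : K) (N : AlgebraicClosure K → ℝ) (d t : ℝ), 0 < d ∧ 0 < t ∧ t < 1 ∧
      ∀ (n : ℕ) (a : AlgebraicClosure K), n ≠ 0 → a ^ n = algebraMap K _ c →
        0 ≤ N a ∧ N a ^ n = t ∧
        adelicHeight σ (arealFamily S fun _ => 1) (a : OnePoint (AlgebraicClosure K)) =
          adelicHeight σ (arealFamily S fun _ => 1) OnePoint.infty +
            d * ((N a ^ 2 - 1) / 2 - Real.log (N a)) := by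
  have hd : (0 : ℝ) < Module.finrank ℚ K := Nat.cast_pos.2 Module.finrank_pos
  have hne : ∀ {c : K} {n : ℕ} {a : AlgebraicClosure K}, c ≠ 0 → n ≠ 0 →
      a ^ n = algebraMap K _ c → a ≠ 0 := by
    rintro c n a hc hn ha rfl
    rw [zero_pow hn] at ha
    exact hc ((_root_.map_eq_zero (algebraMap K (AlgebraicClosure K))).1 ha.symm)
  obtain ⟨w | w, hw⟩ := hS
  · obtain ⟨x, hx0, hinf, hfin, hlt⟩ := exists_large_only_at_infinite w
    have hc0 : x⁻¹ ≠ 0 := inv_ne_zero hx0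
    have hlt1 : w x⁻¹ < 1 := by
      rw [map_inv₀]
      exact inv_lt_one_of_one_lt₀ hlt
    -- As x is large only at w, its inverse is small only at w, and every other defect of its
    -- radicals vanishes.
    refine ⟨x⁻¹, fun a => ‖σ.inf w a‖, w.mult / (Module.finrank ℚ K : ℝ), w x⁻¹,
      div_pos (Nat.cast_pos.2 w.mult_pos) hd, InfinitePlace.pos_iff.2 hc0, hlt1, ?_⟩
    intro n a hn ha
    have hN := norm_conj_pow_eq (σ.inf w) ha (self_mem_conjSet a)
    rw [σ.norm_inf] at hN
    have ha1 : ‖σ.inf w a‖ < 1 := by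
      rw [← hN] at hlt1
      exact (pow_lt_one_iff_of_nonneg (norm_nonneg _) hn).1 hlt1
    refine ⟨norm_nonneg _, hN, ?_⟩
    rw [adelicHeight_coe S σ (hne hc0 hn ha)]
    congr 1
    rw [Finset.sum_eq_single w (fun v _ hv => ?_) (by simp), finsum_eq_zero_of_forall_eq_zero
      fun v => ?_, add_zero, defectInf, average_conjSet_eq _ hn ha, localDefect_eq_of_mem hw ha1]
    · rw [defectFin, average_conjSet_localDefect_eq_zero _ S _ hn ha, mul_zero]
      rw [map_inv₀, map_inv₀, norm_inv]
      exact (one_le_inv₀ (by simpa using hx0)).2 ((norm_fin_le_one_iff σ v x).2 (hfin v))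
    · rw [defectInf, average_conjSet_localDefect_eq_zero _ S _ hn ha, mul_zero]
      rw [σ.norm_inf, map_inv₀]
      exact (one_le_inv₀ (InfinitePlace.pos_iff.2 hx0)).2 (hinf v hv)
  · obtain ⟨x, hx0, hinf, hfin, hlt⟩ := exists_large_only_at_finite w
    have hc0 : x⁻¹ ≠ 0 := inv_ne_zero hx0
    have hlt1 : ‖σ.fin w (algebraMap K _ x⁻¹)‖ < 1 := by
      rw [map_inv₀, map_inv₀, norm_inv]
      exact inv_lt_one_of_one_lt₀ (not_le.1 (mt (norm_fin_le_one_iff σ w x).1 (not_le.2 hlt)))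
    refine ⟨x⁻¹, fun a => ‖σ.fin w a‖, finiteLocalDegree w / (Module.finrank ℚ K : ℝ),
      ‖σ.fin w (algebraMap K _ x⁻¹)‖,
      div_pos (Nat.cast_pos.2 (finiteLocalDegree_pos σ w)) hd, by simpa using hx0, hlt1, ?_⟩
    intro n a hn ha
    have hN := norm_conj_pow_eq (σ.fin w) ha (self_mem_conjSet a)
    have ha1 : ‖σ.fin w a‖ < 1 := by
      rw [← hN] at hlt1
      exact (pow_lt_one_iff_of_nonneg (norm_nonneg _) hn).1 hlt1
    refine ⟨norm_nonneg _, hN, ?_⟩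
    rw [adelicHeight_coe S σ (hne hc0 hn ha)]
    congr 1
    rw [Finset.sum_eq_zero (fun v _ => ?_), finsum_eq_single _ w
      (fun v hv => ?_), zero_add, defectFin, average_conjSet_eq _ hn ha,
      localDefect_eq_of_mem hw ha1]
    · rw [defectFin, average_conjSet_localDefect_eq_zero _ S _ hn ha, mul_zero]
      rw [map_inv₀, map_inv₀, norm_inv]
      exact (one_le_inv₀ (by simpa using hx0)).2 ((norm_fin_le_one_iff σ v x).2 (hfin v hv))
    · rw [defectInf, average_conjSet_localDefect_eq_zero _ S _ hn ha, mul_zero]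
      rw [σ.norm_inf, map_inv₀]
      exact (one_le_inv₀ (InfinitePlace.pos_iff.2 hx0)).2 (hinf v)

end Sequence

/-- Because (1 + y + y²/2)(1 - y + y²/2) = 1 + y⁴/4. -/
theorem exp_neg_le_quadratic {y : ℝ} (hy : 0 ≤ y) : Real.exp (-y) ≤ 1 - y + y ^ 2 / 2 := by
  have h := Real.quadratic_le_exp_of_nonneg hy
  have hpos : 0 < 1 + y + y ^ 2 / 2 := by positivity
  rw [Real.exp_neg]
  calc (Real.exp y)⁻¹ ≤ (1 + y + y ^ 2 / 2)⁻¹ := inv_anti₀ hpos h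
    _ ≤ 1 - y + y ^ 2 / 2 := by
      rw [inv_le_iff_one_le_mul₀ hpos]
      nlinarith [sq_nonneg (y ^ 2)]

/-- Expand r² = exp(2 log r) to second order: the terms linear in log r cancel. This quadratic decay
outweighs the linear growth of the degree. -/
theorem arealDefect_le_log_sq {r : ℝ} (hr0 : 0 < r) (hr1 : r < 1) :
    (r ^ 2 - 1) / 2 - Real.log r ≤ Real.log r ^ 2 := by
  have hlog : Real.log r < 0 := Real.log_neg hr0 hr1
  have h := exp_neg_le_quadratic (y := -(2 * Real.log r)) (by linarith)
  have he : Real.exp (2 * Real.log r) = r ^ 2 := by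
    rw [two_mul, Real.exp_add, Real.exp_log hr0, sq]
  rw [neg_neg, he] at h
  linarith

/-! ### The sequence of radicals and the essential minimum -/

section Main

variable {K : Type*} [Field K] [NumberField K]

theorem exists_sequence (σ : PlaceEmbeddings K) {S : Finset (Place K)} (hS : S.Nonempty) :
    ∃ α : ℕ → OnePoint (AlgebraicClosure K), Function.Injective α ∧
      (∀ n, adelicHeight σ (arealFamily S fun _ => 1) OnePoint.infty <
        adelicHeight σ (arealFamily S fun _ => 1) (α n)) ∧
      Tendsto (fun n => (pointDegree (α n) : ℝ) *
        (adelicHeight σ (arealFamily S fun _ => 1) (α n) -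
          adelicHeight σ (arealFamily S fun _ => 1) OnePoint.infty)) atTop (𝓝 0) := by
  obtain ⟨c, N, d, t, hd, ht0, ht1, H⟩ := exists_adelicHeight_radical σ hS
  -- The index n stands for a root of order n + 1, so the order is never 0.
  choose a ha using fun n : ℕ => IsAlgClosed.exists_pow_nat_eq
    (algebraMap K (AlgebraicClosure K) c) n.succ_pos
  have hN0 : ∀ n, 0 < N (a n) := fun n => by
    obtain ⟨h1, h2, -⟩ := H _ _ n.succ_ne_zero (ha n)
    refine h1.lt_of_ne fun h => ?_
    rw [← h, zero_pow n.succ_ne_zero] at h2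
    exact ht0.ne h2
  have hNt : ∀ n, N (a n) ^ (n + 1) = t := fun n => (H _ _ n.succ_ne_zero (ha n)).2.1
  have hN1 : ∀ n, N (a n) < 1 := fun n =>
    (pow_lt_one_iff_of_nonneg (hN0 n).le n.succ_ne_zero).1 ((hNt n).trans_lt ht1)
  have hdiff : ∀ n, adelicHeight σ (arealFamily S fun _ => 1)
      ((a n : AlgebraicClosure K) : OnePoint (AlgebraicClosure K)) -
        adelicHeight σ (arealFamily S fun _ => 1) OnePoint.infty =
      d * ((N (a n) ^ 2 - 1) / 2 - Real.log (N (a n))) := fun n => by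
    rw [(H _ _ n.succ_ne_zero (ha n)).2.2, add_sub_cancel_left]
  have hpos : ∀ n, 0 < d * ((N (a n) ^ 2 - 1) / 2 - Real.log (N (a n))) :=
    fun n => mul_pos hd (arealDefect_pos (hN0 n) (hN1 n))
  refine ⟨fun n => a n, fun m n hmn => ?_, fun n => ?_, ?_⟩
  · have hmn' : a m = a n := OnePoint.coe_injective hmn
    have h := (hNt m).trans (hNt n).symm
    rw [hmn'] at h
    -- Powers of a number strictly between 0 and 1 determine their exponent.
    exact Nat.succ_injective ((pow_right_inj₀ (hN0 n) (hN1 n).ne).1 h)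
  · exact sub_pos.1 ((hpos n).trans_eq (hdiff n).symm)
  · simp only [hdiff]
    refine squeeze_zero (g := fun n : ℕ => d * Real.log t ^ 2 * (1 / ((n : ℝ) + 1)))
      (fun n => mul_nonneg (Nat.cast_nonneg _) (hpos n).le) (fun n => ?_) ?_
    · have hlog : Real.log (N (a n)) = Real.log t / (n + 1) := by
        rw [← hNt n, Real.log_pow]
        push_cast
        field_simp
      calc _ ≤ ((n + 1 : ℕ) : ℝ) * (d * Real.log (N (a n)) ^ 2) := by
            refine mul_le_mul ?_ ?_ (hpos n).le (Nat.cast_nonneg _)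
            · exact Nat.cast_le.2 (pointDegree_le_of_pow_eq n.succ_ne_zero (ha n))
            · exact mul_le_mul_of_nonneg_left (arealDefect_le_log_sq (hN0 n) (hN1 n)) hd.le
        _ = d * Real.log t ^ 2 * (1 / ((n : ℝ) + 1)) := by
            rw [hlog]
            push_cast
            field_simp
    · simpa using tendsto_one_div_add_atTop_nhds_zero_nat.const_mul (d * Real.log t ^ 2)

/-- The lower bound fails at most at the point 0, which the cofinite filter ignores. For the upper
bound, degrees are at least 1, so the excess heights tend to 0 along infinitely many distinct
points. -/
theorem essentialMinimum_eq (σ : PlaceEmbeddings K) {S : Finset (Place K)} (hS : S.Nonempty) :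
    essentialMinimum σ (arealFamily S fun _ => 1) =
      adelicHeight σ (arealFamily S fun _ => 1) OnePoint.infty := by
  obtain ⟨α, hinj, hlt, hlim⟩ := exists_sequence σ hS
  set h := adelicHeight σ (arealFamily S fun _ => 1)
  have hev : ∀ᶠ x in cofinite, h OnePoint.infty ≤ h x :=
    (eventually_cofinite_ne _).mono fun x hx => adelicHeight_infty_le S σ hx
  have hsmall : Tendsto (fun n => h (α n) - h OnePoint.infty) atTop (𝓝 0) := by
    refine squeeze_zero (fun n => (sub_pos.2 (hlt n)).le) (fun n => ?_) hlim
    exact le_mul_of_one_le_left (sub_pos.2 (hlt n)).le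
      (Nat.one_le_cast.2 (pointDegree_pos (α n)))
  have hcof : Tendsto α atTop cofinite := Nat.cofinite_eq_atTop ▸ hinj.tendsto_cofinite
  have hfreq : ∀ ε > 0, ∃ᶠ x in cofinite, h x ≤ h OnePoint.infty + ε := fun ε hε =>
    hcof.frequently (((hsmall.eventually_lt_const hε).mono fun n hn => by linarith).frequently)
  refine le_antisymm (le_of_forall_pos_le_add fun ε hε => ?_) ?_
  · exact liminf_le_of_frequently_le (hfreq ε hε) (isBoundedUnder_of_eventually_ge hev)
  · exact le_liminf_of_le (IsCoboundedUnder.of_frequently_le (hfreq 1 one_pos)) hev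

end Main

end ArealHeight

end

theorem proposition5 (K : Type*) [Field K] [NumberField K]
    (σ : ArealHeight.PlaceEmbeddings K)
    (S : Finset (ArealHeight.Place K)) (hS : S.Nonempty)
    (h : OnePoint (AlgebraicClosure K) → ℝ)
    (hh : h = ArealHeight.adelicHeight σ (ArealHeight.arealFamily S (fun _ => 1)))
    (L : ℝ)
    (hL : L = ArealHeight.essentialMinimum σ (ArealHeight.arealFamily S (fun _ => 1))) :
    (∃ α : ℕ → OnePoint (AlgebraicClosure K), Function.Injective α ∧
      (∀ n, h OnePoint.infty < h (α n)) ∧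
      Tendsto (fun n => (ArealHeight.pointDegree (α n) : ℝ) * (h (α n) - h OnePoint.infty))
        atTop (𝓝 0)) ∧
    L = h OnePoint.infty ∧
    ¬ ∃ ε : ℝ, 0 < ε ∧ ∀ α : OnePoint (AlgebraicClosure K), L < h α →
        ε ≤ (ArealHeight.pointDegree α : ℝ) * (h α - L) := by
  subst hh
  have hseq := ArealHeight.exists_sequence σ hS
  rw [ArealHeight.essentialMinimum_eq σ hS] at hL
  refine ⟨hseq, hL, ?_⟩
  rintro ⟨ε, hε, hbound⟩
  obtain ⟨α, -, hlt, hlim⟩ := hseq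
  -- A uniform gap ε would pass to the limit and give ε ≤ 0.
  refine absurd (ge_of_tendsto' hlim fun n => ?_) (not_le.2 hε)
  rw [← hL]
  exact hbound (α n) (hL.trans_lt (hlt n))
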